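/- An instance of multi-robot task allocation consists of $n$ robots $r_1,\dots,r_n$, $m$ tasks $t_1,\dots,t_m$, requirements $q_1,\dots,q_m\in\mathbb{Z}_{\ge 0}$ and a matrix of non-negative rational costs $c_{ij}$ ($i\in[n]$, $j\in[m]$). An allocation assigns each robot to at most one task; task $t_j$ is handled if at least $q_j$ robots are allocated to it, and the total cost of an allocation is the sum of $c_{ij}$ over all pairs $(i,j)$ such that robot $r_i$ is allocated to task $t_j$. Theorem. There is a deterministic algorithm that, given any instance with $n\ge\sum_{j\in[m]}q_j$, computes an allocation that handles all tasks and has minimum total cost among all allocations handling all tasks. Its running time (on a random access machine, with logarithmic cost) is bounded by a polynomial in the size of the instance. Here the size is that of a list of $n$, $m$, all requirements, the numbers of all robots, and numerators and denominators of all costs, written in binary; in particular it is at least $n+m$. -/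

import Mathlib

/-! ### A random access machine with logarithmic cost

Memory consists of arrays `0, 1, 2, …` of natural numbers; a program is a fixed finite command and
so mentions only finitely many arrays. Every operation is charged the bit lengths of the numbers it
handles (the logarithmic cost criterion), so that, up to a polynomial, the cost is the running time
of a deterministic Turing machine. -/

namespace Ram

/-- `s a i` is the content of cell `i` of array `a`. -/
abbrev Store : Type := ℕ → ℕ → ℕ

inductive Op
  | add
  | sub
  | mul
  | div
  | lt

/-- Subtraction is truncated, division rounds down, comparison returns `1` or `0`. -/
def Op.eval : Op → ℕ → ℕ → ℕ
  | .add, x, y => x + y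
  | .sub, x, y => x - y
  | .mul, x, y => x * y
  | .div, x, y => x / y
  | .lt, x, y => if x < y then 1 else 0

inductive Expr
  | lit (v : ℕ)
  /-- The content of cell `i` of array `a`; the address `i` is itself computed. -/
  | get (a : ℕ) (i : Expr)
  | op (f : Op) (e₁ e₂ : Expr)

def Expr.eval : Expr → Store → ℕ
  | .lit v, _ => v
  | .get a i, s => s a (i.eval s)
  | .op f e₁ e₂, s => f.eval (e₁.eval s) (e₂.eval s)

/-- One unit plus the bit length of the value, for each node of the expression: all constants,
addresses, operands and results are charged. -/
def Expr.cost : Expr → Store → ℕ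
  | .lit v, _ => 1 + Nat.size v
  | .get a i, s => i.cost s + (1 + Nat.size (s a (i.eval s)))
  | .op f e₁ e₂, s => e₁.cost s + e₂.cost s + (1 + Nat.size (f.eval (e₁.eval s) (e₂.eval s)))

inductive Cmd
  | skip
  /-- Write the value of `e` to cell `i` of array `a`. -/
  | assign (a : ℕ) (i e : Expr)
  | seq (c₁ c₂ : Cmd)
  /-- Run `c₁` if `e` is non-zero, and `c₂` otherwise. -/
  | branch (e : Expr) (c₁ c₂ : Cmd)
  /-- Repeat `c` as long as `e` is non-zero. -/
  | loop (e : Expr) (c : Cmd)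

/-- `Exec c s t s'`: the command `c`, started in `s`, terminates in `s'` at total cost `t`. -/
inductive Exec : Cmd → Store → ℕ → Store → Prop
  | skip (s : Store) : Exec .skip s 1 s
  | assign (a : ℕ) (i e : Expr) (s : Store) :
      Exec (.assign a i e) s (1 + i.cost s + e.cost s)
        (Function.update s a (Function.update (s a) (i.eval s) (e.eval s)))
  | seq {c₁ c₂ : Cmd} {s s₁ s₂ : Store} {t₁ t₂ : ℕ} (h₁ : Exec c₁ s t₁ s₁)
      (h₂ : Exec c₂ s₁ t₂ s₂) : Exec (.seq c₁ c₂) s (t₁ + t₂) s₂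
  | branch_true {e : Expr} {c₁ c₂ : Cmd} {s s' : Store} {t : ℕ} (he : e.eval s ≠ 0)
      (h : Exec c₁ s t s') : Exec (.branch e c₁ c₂) s (1 + e.cost s + t) s'
  | branch_false {e : Expr} {c₁ c₂ : Cmd} {s s' : Store} {t : ℕ} (he : e.eval s = 0)
      (h : Exec c₂ s t s') : Exec (.branch e c₁ c₂) s (1 + e.cost s + t) s'
  | loop_stop {e : Expr} {c : Cmd} {s : Store} (he : e.eval s = 0) :
      Exec (.loop e c) s (1 + e.cost s) s
  | loop_step {e : Expr} {c : Cmd} {s s₁ s₂ : Store} {t₁ t₂ : ℕ} (he : e.eval s ≠ 0)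
      (h₁ : Exec c s t₁ s₁) (h₂ : Exec (.loop e c) s₁ t₂ s₂) :
      Exec (.loop e c) s (1 + e.cost s + t₁ + t₂) s₂

/-- The machine is deterministic: the final store and the cost are determined by the start. -/
theorem Exec.deterministic {c : Cmd} {s s₁ s₂ : Store} {t₁ t₂ : ℕ} (h₁ : Exec c s t₁ s₁)
    (h₂ : Exec c s t₂ s₂) : t₁ = t₂ ∧ s₁ = s₂ := by
  induction h₁ generalizing t₂ s₂ with
  | skip => cases h₂; exact ⟨rfl, rfl⟩
  | assign => cases h₂; exact ⟨rfl, rfl⟩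
  | seq _ _ ih₁ ih₂ =>
    cases h₂ with
    | seq k₁ k₂ =>
      obtain ⟨rfl, rfl⟩ := ih₁ k₁
      obtain ⟨rfl, rfl⟩ := ih₂ k₂
      exact ⟨rfl, rfl⟩
  | branch_true he _ ih =>
    cases h₂ with
    | branch_true _ k => obtain ⟨rfl, rfl⟩ := ih k; exact ⟨rfl, rfl⟩
    | branch_false ke _ => exact absurd ke he
  | branch_false he _ ih =>
    cases h₂ with
    | branch_true ke _ => exact absurd he ke
    | branch_false _ k => obtain ⟨rfl, rfl⟩ := ih k; exact ⟨rfl, rfl⟩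
  | loop_stop he =>
    cases h₂ with
    | loop_stop _ => exact ⟨rfl, rfl⟩
    | loop_step ke _ _ => exact absurd he ke
  | loop_step he _ _ ih₁ ih₂ =>
    cases h₂ with
    | loop_stop ke => exact absurd ke he
    | loop_step _ k₁ k₂ =>
      obtain ⟨rfl, rfl⟩ := ih₁ k₁
      obtain ⟨rfl, rfl⟩ := ih₂ k₂
      exact ⟨rfl, rfl⟩

/-- The initial store on input `w`: the length of `w` in cell `0` of array `0`, the entries of `w`
in array `1`, and `0` everywhere else. -/
def Store.init (w : List ℕ) : Store
  | 0, 0 => w.length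
  | 1, i => w.getD i 0
  | _, _ => 0

/-- A store presents the output `y`: its length in cell `0` of array `0`, its entries in array
`1`. -/
def Store.Presents (s : Store) (y : List ℕ) : Prop :=
  s 0 0 = y.length ∧ ∀ (i : ℕ) (hi : i < y.length), s 1 i = y[i]

/-- On input `w` the program `P` halts with output `y` at logarithmic cost at most `T`. -/
def OutputsWithin (P : Cmd) (w y : List ℕ) (T : ℕ) : Prop :=
  ∃ (t : ℕ) (s : Store), Exec P (Store.init w) t s ∧ s.Presents y ∧ t ≤ T

/-- The size of a list of natural numbers written in binary, one separator for each number. -/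
def bitSize (w : List ℕ) : ℕ := (w.map fun x => Nat.size x + 1).sum

end Ram

/-! ### Multi-robot task allocation -/

/-- An instance: `n` robots, `m` tasks, task `j` requires `q j` robots, and assigning robot `i` to
task `j` costs `c i j`, a non-negative rational number. -/
structure TaskInstance where
  n : ℕ
  m : ℕ
  q : Fin m → ℕ
  c : Fin n → Fin m → ℚ≥0

namespace TaskInstance

/-- An allocation assigns every robot to at most one task (`none`: to no task). -/
abbrev Allocation (I : TaskInstance) : Type := Fin I.n → Option (Fin I.m)

/-- Task `j` is handled if at least `q j` robots are allocated to it. -/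
def Handles (I : TaskInstance) (σ : I.Allocation) (j : Fin I.m) : Prop :=
  I.q j ≤ (Finset.univ.filter fun i : Fin I.n => σ i = some j).card

/-- The total cost of an allocation, the sum of `c i j` over all robots `i` that are allocated to
some task `j`. -/
def totalCost (I : TaskInstance) (σ : I.Allocation) : ℚ≥0 :=
  ∑ i : Fin I.n, ∑ j : Fin I.m, if σ i = some j then I.c i j else 0

/-- The allocation handles all tasks, at minimum total cost among all allocations that do. -/
def IsOptimal (I : TaskInstance) (σ : I.Allocation) : Prop :=
  (∀ j, I.Handles σ j) ∧ ∀ τ : I.Allocation, (∀ j, I.Handles τ j) → I.totalCost σ ≤ I.totalCost τ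

/-- The instance as a list of numbers: `n`, `m`, the requirements, and for each robot a record with
its number followed by numerator and denominator of its cost for each task. (Robots are listed
explicitly, so that the size of an instance is at least `n` even if there are no tasks.) -/
def encode (I : TaskInstance) : List ℕ :=
  [I.n, I.m] ++ List.ofFn I.q ++
    (List.finRange I.n).flatMap fun i : Fin I.n =>
      i.val :: (List.finRange I.m).flatMap fun j => [(I.c i j).num, (I.c i j).den]

/-- An allocation as a list of `n` numbers: `0` for a robot without a task, `j + 1` for a robot
allocated to task `j` (tasks are numbered from `0`). -/
def encodeAllocation (I : TaskInstance) (σ : I.Allocation) : List ℕ :=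
  List.ofFn fun i => (σ i).elim 0 fun j => (j : ℕ) + 1

end TaskInstance

/-! Multiplying all costs by the product of their denominators makes them integral without changing
the optimal allocations. What remains is a transportation problem, solved by the Hungarian method.
Potentials `y` of tasks and `z` of robots with `y l ≤ A i l + z i`, with equality on allocated pairs
and `z i = 0` at free robots, certify optimality. Summing over robots, the cost of `σ` equals `∑
count σ l * y l - ∑ z i`, while any `τ` costs at least the same expression with `count τ`. As `y ≥
0`, having more robots on some task cannot make `τ` cheaper (`Dual.weight_le`).

The method starts from the empty allocation with zero potentials and adds one robot at a time. If a
task `j₀` is still short, `n ≥ ∑ q` leaves a free robot (`exists_free`). A search from `j₀` grows a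
tree of tight arcs, raising the potentials inside the tree by the least slack of an arc leaving it
(`Search.step`), and meets a free robot within `n` rounds (`Search.card_lt`). Reading its log
backwards, robots move along tight arcs: `j₀` gains one robot, every other task keeps its number,
and the potentials remain a certificate (`Scan.step_of_ne`, `Scan.step_of_eq`).

For the running time, all loops are bounded by `n` or `m` and all multiplications are by input
numbers. The bit length then grows by an amount that depends on the input size but not on the
current length, so nested loops keep it polynomial (`Prog.Tame.exec`). -/

namespace Ram

/-! ### A language of bounded loops

Programs whose loops run over a range given by a cell have a total denotation; if they multiply only
by cells of a fixed read-only array, which also holds the loop bounds, they run in polynomial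
time. -/

/-- The store after writing `v` to cell `i` of array `a`. -/
def Store.write (s : Store) (a i v : ℕ) : Store :=
  Function.update s a (Function.update (s a) i v)

@[simp] theorem Store.write_self (s : Store) (a i v : ℕ) :
    s.write a i v a = Function.update (s a) i v := by
  simp [Store.write]

@[simp] theorem Store.write_of_ne (s : Store) {a b : ℕ} (h : b ≠ a) (i v : ℕ) :
    s.write a i v b = s b := by
  simp [Store.write, h]

/-- `iter f N s` applies `f 0`, …, `f (N - 1)` to `s`, in this order. -/
def iter {α : Type*} (f : ℕ → α → α) : ℕ → α → α
  | 0, s => s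
  | k + 1, s => f k (iter f k s)

inductive Prog
  | skip
  | assign (a : ℕ) (i e : Expr)
  | seq (p q : Prog)
  | cond (e : Expr) (p q : Prog)
  /-- Run `p` with cell `0` of array `x` equal to `0, 1, …` below the content of cell `k` of array
  `a`. -/
  | forLoop (x a k : ℕ) (p : Prog)

namespace Prog

def compile : Prog → Cmd
  | skip => .skip
  | assign a i e => .assign a i e
  | seq p q => .seq p.compile q.compile
  | cond e p q => .branch e p.compile q.compile
  | forLoop x a k p =>
    .seq (.assign x (.lit 0) (.lit 0))
      (.loop (.op .lt (.get x (.lit 0)) (.get a (.lit k)))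
        (.seq p.compile (.assign x (.lit 0) (.op .add (.get x (.lit 0)) (.lit 1)))))

/-- The loop bound is read once here, whereas the compiled loop reads it in every round; the two
agree when the array with the bound is read-only and the body spares the counter. The last write
gives the counter its value at exit, so that the final stores coincide exactly. -/
def den : Prog → Store → Store
  | skip, s => s
  | assign a i e, s => s.write a (i.eval s) (e.eval s)
  | seq p q, s => q.den (p.den s)
  | cond e p q, s => if e.eval s ≠ 0 then p.den s else q.den s
  | forLoop x a k p, s =>
    (iter (fun i t => p.den (t.write x 0 i)) (s a k) s).write x 0 (s a k)

/-- The arrays that a program may write to. -/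
def writes : Prog → List ℕ
  | skip => []
  | assign a _ _ => [a]
  | seq p q => p.writes ++ q.writes
  | cond _ p q => p.writes ++ q.writes
  | forLoop x _ _ p => x :: p.writes

theorem den_frame (p : Prog) {a : ℕ} (h : a ∉ p.writes) (s : Store) : p.den s a = s a := by
  induction p generalizing s with
  | skip => rfl
  | assign b i e => simp only [writes, List.mem_singleton] at h; simp [den, h]
  | seq p q ihp ihq =>
    simp only [writes, List.mem_append, not_or] at h
    simp only [den]; rw [ihq h.2, ihp h.1]
  | cond e p q ihp ihq =>
    simp only [writes, List.mem_append, not_or] at h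
    simp only [den]; split_ifs
    · exact ihp h.1 s
    · exact ihq h.2 s
  | forLoop x b k p ih =>
    simp only [writes, List.mem_cons, not_or] at h
    simp only [den, Store.write_of_ne _ h.1]
    generalize s b k = N
    induction N with
    | zero => rfl
    | succ N ihN => simp only [iter]; rw [ih h.2, Store.write_of_ne _ h.1, ihN]

/-- The invariant rule for loops; the loop leaves alone the arrays it does not write to. -/
theorem forLoop_inv {x a k N : ℕ} {p : Prog} {s : Store} (P : ℕ → Store → Prop) (hN : s a k = N)
    (h0 : P 0 s)
    (step : ∀ i < N, ∀ t : Store, (∀ b, b ∉ (forLoop x a k p).writes → t b = s b) → P i t →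
      P (i + 1) (p.den (t.write x 0 i)))
    (hx : ∀ t : Store, ∀ v, P N t → P N (t.write x 0 v)) :
    P N ((forLoop x a k p).den s) := by
  simp only [den, hN]
  apply hx
  have key : ∀ K ≤ N, (∀ b, b ∉ (forLoop x a k p).writes →
      iter (fun i t => p.den (t.write x 0 i)) K s b = s b) ∧
      P K (iter (fun i t => p.den (t.write x 0 i)) K s) := by
    intro K
    induction K with
    | zero => exact fun _ => ⟨fun _ _ => rfl, h0⟩
    | succ K ih =>
      intro hK
      obtain ⟨h1, h2⟩ := ih (by omega)
      refine ⟨fun b hb => ?_, step K (by omega) _ h1 h2⟩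
      rw [← h1 b hb]
      simp only [writes, List.mem_cons, not_or] at hb
      simp only [iter]
      rw [den_frame p hb.2, Store.write_of_ne _ hb.1]
  exact (key N le_rfl).2

end Prog

/-! ### Bit lengths and running time of tame programs. -/

/-- Multiplications are by cells of array `R` only. -/
def Expr.Tame (R : ℕ) : Expr → Prop
  | .lit _ => True
  | .get _ i => i.Tame R
  | .op .mul e₁ (.get a i) => a = R ∧ e₁.Tame R ∧ i.Tame R
  | .op .mul _ _ => False
  | .op _ e₁ e₂ => e₁.Tame R ∧ e₂.Tame R

namespace Prog

/-- Array `R` is read-only, multiplications are by its cells, loops are bounded by one of its first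
two cells, and loop bodies leave the counter alone. -/
def Tame (R : ℕ) : Prog → Prop
  | skip => True
  | assign a i e => a ≠ R ∧ i.Tame R ∧ e.Tame R
  | seq p q => p.Tame R ∧ q.Tame R
  | cond e p q => e.Tame R ∧ p.Tame R ∧ q.Tame R
  | forLoop x a k p => x ≠ R ∧ a = R ∧ k ≤ 1 ∧ x ∉ p.writes ∧ p.Tame R

theorem Tame.not_mem_writes {R : ℕ} {p : Prog} (h : p.Tame R) : R ∉ p.writes := by
  induction p with
  | skip => simp [writes]
  | assign a i e => simpa [writes] using h.1.symm
  | seq p q ihp ihq => simp [writes, ihp h.1, ihq h.2]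
  | cond e p q ihp ihq => simp [writes, ihp h.2.1, ihq h.2.2]
  | forLoop x a k p ih => simp [writes, ih h.2.2.2.2, h.1.symm]

end Prog

/-- All cells have at most `b` bits, those of array `R` fewer than `N`, and the first two cells of
`R` are at most `N`. -/
structure Store.Bounded (s : Store) (R N b : ℕ) : Prop where
  cell : ∀ a i, s a i < 2 ^ b
  ro : ∀ i, s R i < 2 ^ N
  pos : 0 < N
  bound : ∀ k ≤ 1, s R k ≤ N

/-- A product with a cell of `R` adds at most `N` bits; every other operation adds at most one bit
to the longer operand. A literal `v` is below `2 ^ v`, and `N > 0` absorbs it. The growth is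
additive in `b`, which is what allows iteration. -/
theorem Expr.eval_lt {R : ℕ} (e : Expr) (he : e.Tame R) :
    ∃ w : ℕ, ∀ (s : Store) (N b : ℕ), s.Bounded R N b →
      e.eval s < 2 ^ (b + w * N) := by
  induction e with
  | lit v =>
    refine ⟨v, fun s N b h => (Nat.lt_two_pow_self (n := v)).trans_le ?_⟩
    exact Nat.pow_le_pow_right two_pos ((Nat.le_mul_of_pos_right v h.pos).trans le_add_self)
  | get a i ih => exact ⟨0, fun s N b h => by simpa [Expr.eval] using h.cell a _⟩
  | op f e₁ e₂ ih₁ ih₂ =>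
    have aux : e₁.Tame R → e₂.Tame R → f ≠ .mul → ∃ w : ℕ, ∀ (s : Store) (N b : ℕ),
        s.Bounded R N b → (Expr.op f e₁ e₂).eval s < 2 ^ (b + w * N) := by
      intro h₁ h₂ hf
      obtain ⟨w₁, k₁⟩ := ih₁ h₁
      obtain ⟨w₂, k₂⟩ := ih₂ h₂
      refine ⟨w₁ + w₂ + 1, fun s N b h => ?_⟩
      have l₁ := k₁ s N b h
      have l₂ := k₂ s N b h
      have e : 2 ^ (b + (w₁ + w₂) * N + 1) ≤ 2 ^ (b + (w₁ + w₂ + 1) * N) :=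
        Nat.pow_le_pow_right two_pos (by have := h.pos; nlinarith)
      have m₁ : 2 ^ (b + w₁ * N) ≤ 2 ^ (b + (w₁ + w₂) * N) :=
        Nat.pow_le_pow_right two_pos (by nlinarith)
      have m₂ : 2 ^ (b + w₂ * N) ≤ 2 ^ (b + (w₁ + w₂) * N) :=
        Nat.pow_le_pow_right two_pos (by nlinarith)
      refine lt_of_lt_of_le ?_ e
      rw [pow_succ]
      have hpos : 0 < 2 ^ (b + (w₁ + w₂) * N) := by positivity
      simp only [Expr.eval]
      cases f with
      | add => simp only [Op.eval]; omega
      | sub => simp only [Op.eval]; omega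
      | mul => exact absurd rfl hf
      | div =>
        simp only [Op.eval]
        have := Nat.div_le_self (e₁.eval s) (e₂.eval s)
        omega
      | lt => simp only [Op.eval]; split_ifs <;> omega
    cases f with
    | mul =>
      cases e₂ with
      | get a i =>
        obtain ⟨rfl, h₁, -⟩ := he
        obtain ⟨w₁, k₁⟩ := ih₁ h₁
        refine ⟨w₁ + 1, fun s N b h => ?_⟩
        have := Nat.mul_lt_mul'' (k₁ s N b h) (h.ro (i.eval s))
        rw [← pow_add] at this
        simpa [Expr.eval, Op.eval, add_mul, add_assoc] using this
      | lit v => exact he.elim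
      | op g a b => exact he.elim
    | add => exact aux he.1 he.2 (by simp)
    | sub => exact aux he.1 he.2 (by simp)
    | div => exact aux he.1 he.2 (by simp)
    | lt => exact aux he.1 he.2 (by simp)

theorem Expr.size_eval_le {R : ℕ} (e : Expr) (he : e.Tame R) :
    ∃ w : ℕ, ∀ (s : Store) (N b : ℕ), s.Bounded R N b →
      1 + Nat.size (e.eval s) ≤ w * N * (1 + b) := by
  obtain ⟨w, k⟩ := e.eval_lt he
  refine ⟨w + 1, fun s N b h => ?_⟩
  have := Nat.size_le.2 (k s N b h)
  have := h.pos
  nlinarith [Nat.zero_le (w * N * b), Nat.mul_le_mul_right b this]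

theorem Expr.cost_le {R : ℕ} (e : Expr) (he : e.Tame R) :
    ∃ w : ℕ, ∀ (s : Store) (N b : ℕ), s.Bounded R N b → e.cost s ≤ w * N * (1 + b) := by
  induction e with
  | lit v => exact Expr.size_eval_le (.lit v) he
  | get a i ih =>
    obtain ⟨w₁, k₁⟩ := ih he
    obtain ⟨w, k⟩ := Expr.size_eval_le (.get a i) he
    refine ⟨w₁ + w, fun s N b h => ?_⟩
    rw [add_mul, add_mul]
    exact add_le_add (k₁ s N b h) (k s N b h)
  | op f e₁ e₂ ih₁ ih₂ =>
    have h₁₂ : e₁.Tame R ∧ e₂.Tame R := by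
      cases f with
      | mul =>
        cases e₂ with
        | get a i => exact ⟨he.2.1, he.2.2⟩
        | lit v => exact he.elim
        | op g a b => exact he.elim
      | _ => exact he
    obtain ⟨w₁, k₁⟩ := ih₁ h₁₂.1
    obtain ⟨w₂, k₂⟩ := ih₂ h₁₂.2
    obtain ⟨w, k⟩ := Expr.size_eval_le (.op f e₁ e₂) he
    refine ⟨w₁ + w₂ + w, fun s N b h => ?_⟩
    rw [add_mul, add_mul, add_mul, add_mul]
    exact add_le_add (add_le_add (k₁ s N b h) (k₂ s N b h)) (k s N b h)

theorem Store.Bounded.mono {s : Store} {R N b b' : ℕ} (h : s.Bounded R N b) (hb : b ≤ b') :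
    s.Bounded R N b' :=
  ⟨fun a i => (h.cell a i).trans_le (Nat.pow_le_pow_right two_pos hb), h.ro, h.pos, h.bound⟩

theorem Store.Bounded.write {s : Store} {R N b a i v : ℕ} (h : s.Bounded R N b) (ha : a ≠ R)
    (hv : v < 2 ^ b) : (s.write a i v).Bounded R N b := by
  refine ⟨fun c j => ?_, fun j => ?_, h.pos, fun k hk => ?_⟩
  · by_cases hc : c = a
    · subst hc
      by_cases hj : j = i
      · subst hj; simpa
      · simpa [hj] using h.cell c j
    · simpa [hc] using h.cell c j
  · rw [Store.write_of_ne _ ha.symm]; exact h.ro j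
  · rw [Store.write_of_ne _ ha.symm]; exact h.bound k hk

open Polynomial in
/-- Tame programs run in polynomial time and lengthen the contents of cells by polynomially many
bits. -/
theorem Prog.Tame.exec {R : ℕ} {p : Prog} (hp : p.Tame R) :
    ∃ G C : ℕ[X], ∀ (s : Store) (N b : ℕ), s.Bounded R N b →
      (p.den s).Bounded R N (b + G.eval N) ∧
      ∃ t ≤ C.eval N * (1 + b), Exec p.compile s t (p.den s) := by
  -- The increment `G` must not depend on `b`: then `N` rounds of a loop add `N * G` bits, whereas
  -- growth by a factor in each round would be exponential.
  induction p with
  | skip => exact ⟨0, 1, fun s N b h => ⟨by simpa [den] using h, 1, by simp, .skip s⟩⟩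
  | assign a i e =>
    obtain ⟨g, hg⟩ := e.eval_lt hp.2.2
    obtain ⟨w₁, k₁⟩ := i.cost_le hp.2.1
    obtain ⟨w₂, k₂⟩ := e.cost_le hp.2.2
    refine ⟨(g : ℕ[X]) * X, 1 + (w₁ : ℕ[X]) * X + (w₂ : ℕ[X]) * X, fun s N b h => ⟨?_, _, ?_,
      .assign a i e s⟩⟩
    · have := hg s N b h
      simp only [eval_mul, eval_natCast, eval_X]
      exact (h.mono le_self_add).write hp.1 (by simpa using this)
    · have := k₁ s N b h
      have := k₂ s N b h
      simp only [eval_add, eval_mul, eval_natCast, eval_X, eval_one, Nat.cast_id]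
      nlinarith
  | seq p q ihp ihq =>
    obtain ⟨G₁, C₁, k₁⟩ := ihp hp.1
    obtain ⟨G₂, C₂, k₂⟩ := ihq hp.2
    refine ⟨G₁ + G₂, C₁ + C₂ * (1 + G₁), fun s N b h => ?_⟩
    obtain ⟨h₁, t₁, l₁, e₁⟩ := k₁ s N b h
    obtain ⟨h₂, t₂, l₂, e₂⟩ := k₂ _ N _ h₁
    refine ⟨by simpa [den, add_assoc] using h₂, _, ?_, .seq e₁ e₂⟩
    simp only [eval_add, eval_mul, eval_one]
    have : C₂.eval N * (1 + (b + G₁.eval N)) ≤ C₂.eval N * (1 + G₁.eval N) * (1 + b) := by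
      rw [mul_assoc]
      exact Nat.mul_le_mul_left _ (by nlinarith [Nat.zero_le (G₁.eval N * b)])
    linarith
  | cond e p q ihp ihq =>
    obtain ⟨w, k⟩ := e.cost_le hp.1
    obtain ⟨G₁, C₁, k₁⟩ := ihp hp.2.1
    obtain ⟨G₂, C₂, k₂⟩ := ihq hp.2.2
    refine ⟨G₁ + G₂, 1 + (w : ℕ[X]) * X + C₁ + C₂, fun s N b h => ?_⟩
    have := k s N b h
    simp only [eval_add, eval_mul, eval_natCast, eval_X, eval_one, Nat.cast_id]
    by_cases he : e.eval s = 0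
    · obtain ⟨h₂, t₂, l₂, e₂⟩ := k₂ s N b h
      have hd : (cond e p q).den s = q.den s := by simp [den, he]
      rw [hd]
      exact ⟨h₂.mono (by omega), _, by nlinarith [Nat.zero_le (C₁.eval N * (1 + b))],
        .branch_false he e₂⟩
    · obtain ⟨h₁, t₁, l₁, e₁⟩ := k₁ s N b h
      have hd : (cond e p q).den s = p.den s := by simp [den, he]
      rw [hd]
      exact ⟨h₁.mono (by omega), _, by nlinarith [Nat.zero_le (C₂.eval N * (1 + b))],
        .branch_true he e₁⟩
  | forLoop x a k p ih =>
    obtain ⟨hx, rfl, hk, hxp, hp⟩ := hp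
    obtain ⟨G, C, hGC⟩ := ih hp
    obtain ⟨w₀, c₀⟩ := Expr.cost_le (R := a) (.lit 0) trivial
    obtain ⟨w₁, c₁⟩ := Expr.cost_le (R := a) (.op .lt (.get x (.lit 0)) (.get a (.lit k)))
      ⟨trivial, trivial⟩
    obtain ⟨w₂, c₂⟩ := Expr.cost_le (R := a) (.op .add (.get x (.lit 0)) (.lit 1))
      ⟨trivial, trivial⟩
    -- In `X + X * G`, the first `X` makes room for the counter, which is at most `N < 2 ^ N`, and
    -- `X * G` for at most `N` runs of the body. The factor `1 + (X + X * G + G)` converts the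
    -- largest length met during the loop into a multiple of `1 + b`.
    refine ⟨X + X * G, (1 + (w₀ : ℕ[X]) * X + (w₀ : ℕ[X]) * X) +
      (X + 1) * ((1 + (w₁ : ℕ[X]) * X + C + (1 + (w₀ : ℕ[X]) * X + (w₂ : ℕ[X]) * X)) *
        (1 + (X + X * G + G))), fun s N b h => ?_⟩
    set f : ℕ → Store → Store := fun i t => p.den (t.write x 0 i) with hf
    have hMN : s a k ≤ N := h.bound k hk
    set M := s a k with hM
    have hN2 : N < 2 ^ (b + N) :=
      Nat.lt_two_pow_self.trans_le (Nat.pow_le_pow_right two_pos le_add_self)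
    have hst : ∀ K ≤ N, (iter f K s).Bounded a N (b + (N + K * G.eval N)) := by
      intro K
      induction K with
      | zero => intro _; simpa [iter] using h.mono le_self_add
      | succ K ihK =>
        intro hK
        have hb := ihK (by omega)
        have := (hGC _ N _ (hb.write (i := 0) (v := K) hx
          ((show K < N by omega).trans_le (hN2.le.trans
            (Nat.pow_le_pow_right two_pos (by omega)))))).1
        exact this.mono (by rw [add_mul]; omega)
    have hw : ∀ K ≤ M, ((iter f K s).write x 0 K).Bounded a N (b + (N + K * G.eval N)) := by
      intro K hK
      exact (hst K (by omega)).write hx ((show K ≤ N by omega).trans_lt (hN2.trans_le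
            (Nat.pow_le_pow_right two_pos (by omega))))
    have hro : ∀ K, iter f K s a = s a := by
      intro K
      induction K with
      | zero => rfl
      | succ K ihK =>
        simp only [iter, hf]
        rw [den_frame p hp.not_mem_writes, Store.write_of_ne _ hx.symm]; exact ihK
    have hd : (forLoop x a k p).den s = (iter f M s).write x 0 M := rfl
    rw [hd]
    refine ⟨(hw M le_rfl).mono ?_, ?_⟩
    · simp only [eval_add, eval_mul, eval_X]
      have := Nat.mul_le_mul_right (G.eval N) hMN
      omega
    set Q := (1 + w₁ * N + C.eval N + (1 + w₀ * N + w₂ * N)) *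
        (1 + (N + N * G.eval N + G.eval N)) with hQ
    -- Induction on the number `r` of rounds still to run, because `Exec.loop_step` peels off the
    -- first round while `iter` unfolds at the last one.
    have hloop : ∀ r K, r + K = M → ∃ t ≤ (r + 1) * (Q * (1 + b)),
        Exec (.loop (.op .lt (.get x (.lit 0)) (.get a (.lit k)))
        (.seq p.compile (.assign x (.lit 0) (.op .add (.get x (.lit 0)) (.lit 1)))))
        ((iter f K s).write x 0 K) t ((iter f M s).write x 0 M) := by
      intro r
      induction r with
      | zero =>
        intro K hK
        obtain rfl : K = M := by omega
        refine ⟨_, ?_, Exec.loop_stop ?_⟩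
        · have := c₁ _ _ _ ((hw M le_rfl).mono (b' := b + (N + N * G.eval N + G.eval N)) (by
            have := Nat.mul_le_mul_right (G.eval N) hMN
            omega))
          calc _ ≤ (1 + w₁ * N + C.eval N + (1 + w₀ * N + w₂ * N)) *
                (1 + (b + (N + N * G.eval N + G.eval N))) := by
                rw [add_mul, add_mul, add_mul]
                have : 1 ≤ 1 * (1 + (b + (N + N * G.eval N + G.eval N))) := by omega
                omega
            _ ≤ (1 + w₁ * N + C.eval N + (1 + w₀ * N + w₂ * N)) *
                ((1 + (N + N * G.eval N + G.eval N)) * (1 + b)) :=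
                Nat.mul_le_mul_left _ (by
                  nlinarith [Nat.zero_le ((N + N * G.eval N + G.eval N) * b)])
            _ = _ := by rw [hQ]; ring
        · simp [Expr.eval, Op.eval, Store.write_of_ne _ hx.symm, hro, ← hM]
      | succ r ihr =>
        intro K hK
        obtain ⟨t₂, l₂, e₂⟩ := ihr (K + 1) (by omega)
        have hKb := hw K (by omega)
        obtain ⟨hb₁, t₁, l₁, e₁⟩ := hGC _ N _ hKb
        have hKN : K * G.eval N ≤ N * G.eval N := Nat.mul_le_mul_right _ (by omega)
        set B := b + (N + N * G.eval N + G.eval N) with hB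
        have a₁ := c₁ _ _ B (hKb.mono (by omega))
        have a₀ := c₀ _ _ B (hb₁.mono (by omega))
        have a₂ := c₂ _ _ B (hb₁.mono (by omega))
        have hx1 : p.den ((iter f K s).write x 0 K) x 0 = K := by
          rw [den_frame p hxp]; simp
        have e₃ := Exec.assign x (.lit 0) (.op .add (.get x (.lit 0)) (.lit 1))
          (p.den ((iter f K s).write x 0 K))
        have hst' : Function.update (p.den ((iter f K s).write x 0 K)) x
            (Function.update (p.den ((iter f K s).write x 0 K) x)
              ((Expr.lit 0).eval (p.den ((iter f K s).write x 0 K)))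
              ((Expr.op .add (.get x (.lit 0)) (.lit 1)).eval
                (p.den ((iter f K s).write x 0 K)))) = (iter f (K + 1) s).write x 0 (K + 1) := by
          simp only [Expr.eval, Op.eval, hx1]; rfl
        rw [hst'] at e₃
        refine ⟨_, ?_, .loop_step ?_ (.seq e₁ e₃) e₂⟩
        · have l₁' : t₁ ≤ C.eval N * (1 + B) := l₁.trans (Nat.mul_le_mul_left _ (by omega))
          have round : 1 + (Expr.op .lt (.get x (.lit 0)) (.get a (.lit k))).cost
              ((iter f K s).write x 0 K) + (t₁ + (1 + (Expr.lit 0).cost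
                (p.den ((iter f K s).write x 0 K)) + (Expr.op .add (.get x (.lit 0)) (.lit 1)).cost
                (p.den ((iter f K s).write x 0 K)))) ≤ Q * (1 + b) := by
            calc _ ≤ (1 + w₁ * N + C.eval N + (1 + w₀ * N + w₂ * N)) * (1 + B) := by
                  simp only [add_mul]
                  have : 1 ≤ 1 * (1 + B) := by omega
                  omega
              _ ≤ (1 + w₁ * N + C.eval N + (1 + w₀ * N + w₂ * N)) *
                  ((1 + (N + N * G.eval N + G.eval N)) * (1 + b)) :=
                  Nat.mul_le_mul_left _ (by
                    nlinarith [Nat.zero_le ((N + N * G.eval N + G.eval N) * b)])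
              _ = _ := by rw [hQ]; ring
          rw [add_mul (r + 1) 1, one_mul]
          omega
        · have : K < M := by omega
          simp [Expr.eval, Op.eval, Store.write_of_ne _ hx.symm, hro, ← hM, this]
    obtain ⟨t, lt, et⟩ := hloop M 0 (by omega)
    refine ⟨_, ?_, .seq (.assign x (.lit 0) (.lit 0) s) et⟩
    simp only [eval_add, eval_mul, eval_natCast, eval_X, eval_one, Nat.cast_id]
    rw [← hQ]
    have a₀ := c₀ s N b h
    have : (M + 1) * (Q * (1 + b)) ≤ (N + 1) * (Q * (1 + b)) := Nat.mul_le_mul_right _ (by omega)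
    have e : (1 + w₀ * N + w₀ * N + (N + 1) * Q) * (1 + b) =
      (1 + b) + w₀ * N * (1 + b) + w₀ * N * (1 + b) + (N + 1) * (Q * (1 + b)) := by ring
    rw [e]
    omega

end Ram

/-! ### The primal-dual method

Labels `1, …, m` are tasks, label `0` stands for no task; `A i l` is an integral cost. -/

namespace Assignment

open Finset

/-- `y` and `z` are potentials of the labels and of the robots that are dual feasible and
complementary to the labelling `σ`. -/
structure Dual (n m : ℕ) (A : ℕ → ℕ → ℕ) (σ y z : ℕ → ℕ) : Prop where
  label_le : ∀ i < n, σ i ≤ m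
  feasible : ∀ i < n, ∀ l, 1 ≤ l → l ≤ m → y l ≤ A i l + z i
  tight : ∀ i < n, σ i ≠ 0 → A i (σ i) + z i = y (σ i)
  free : ∀ i < n, σ i = 0 → z i = 0

/-- The number of robots with label `l`. -/
def count (n : ℕ) (σ : ℕ → ℕ) (l : ℕ) : ℕ := #{i ∈ range n | σ i = l}

/-- The total of `w i (σ i)` over all robots `i` with a task. -/
def weight (n : ℕ) (w : ℕ → ℕ → ℕ) (σ : ℕ → ℕ) : ℕ :=
  ∑ i ∈ range n, if σ i = 0 then 0 else w i (σ i)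

variable {n m : ℕ} {A : ℕ → ℕ → ℕ} {σ y z : ℕ → ℕ}

theorem weight_eq_sum_count (hσ : ∀ i < n, σ i ≤ m) :
    weight n (fun _ l => y l) σ = ∑ l ∈ Icc 1 m, count n σ l * y l := by
  simp only [weight, count, card_filter, sum_mul, ite_mul, one_mul, zero_mul]
  rw [sum_comm]
  refine sum_congr rfl fun i hi => ?_
  rw [sum_ite_eq]
  have := hσ i (mem_range.1 hi)
  by_cases h : σ i = 0
  · simp [h]
  · rw [if_neg h, if_pos (mem_Icc.2 ⟨by omega, this⟩)]

/-- A labelling with complementary potentials has minimum weight. -/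
theorem Dual.weight_le (h : Dual n m A σ y z) {τ : ℕ → ℕ} (hτ : ∀ i < n, τ i ≤ m)
    (hc : ∀ l, 1 ≤ l → l ≤ m → count n σ l ≤ count n τ l) : weight n A σ ≤ weight n A τ := by
  have h₁ : weight n A σ + ∑ i ∈ range n, z i = weight n (fun _ l => y l) σ := by
    rw [weight, weight, ← sum_add_distrib]
    refine sum_congr rfl fun i hi => ?_
    have hi := mem_range.1 hi
    split_ifs with h0
    · simp [h.free i hi h0]
    · exact h.tight i hi h0
  have h₂ : weight n (fun _ l => y l) τ ≤ weight n A τ + ∑ i ∈ range n, z i := by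
    rw [weight, weight, ← sum_add_distrib]
    refine sum_le_sum fun i hi => ?_
    have hi := mem_range.1 hi
    split_ifs with h0
    · simp
    · exact h.feasible i hi _ (by omega) (hτ i hi)
  rw [weight_eq_sum_count h.label_le] at h₁
  rw [weight_eq_sum_count hτ] at h₂
  -- Non-negativity of `y`, built into the type `ℕ`, lets `τ` exceed the counts of `σ`.
  have h₃ : ∑ l ∈ Icc 1 m, count n σ l * y l ≤ ∑ l ∈ Icc 1 m, count n τ l * y l :=
    sum_le_sum fun l hl => Nat.mul_le_mul_right _ (hc l (mem_Icc.1 hl).1 (mem_Icc.1 hl).2)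
  omega

theorem sum_count (hσ : ∀ i < n, σ i ≤ m) : ∑ l ∈ range (m + 1), count n σ l = n := by
  have := card_eq_sum_card_fiberwise (s := range n) (t := range (m + 1)) (f := σ)
    (fun i hi => by
      simp only [coe_range, Set.mem_Iio] at hi ⊢
      exact Nat.lt_succ_of_le (hσ i hi))
  simpa [count] using this.symm

/-- Stated additively to avoid truncated subtraction; this also covers the case `l = σ i`, where
nothing changes. -/
theorem count_update {i l : ℕ} (hi : i < n) (k : ℕ) :
    count n (Function.update σ i l) k + (if k = σ i then 1 else 0) =
      count n σ k + if k = l then 1 else 0 := by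
  have key : ∀ τ : ℕ → ℕ, count n τ k = #{j ∈ (range n).erase i | τ j = k} +
      if k = τ i then 1 else 0 := by
    intro τ
    rw [count, ← insert_erase (mem_range.2 hi), filter_insert]
    by_cases h : τ i = k
    · rw [if_pos h, card_insert_of_notMem (by simp), if_pos h.symm]
      simp
    · rw [if_neg h, if_neg (Ne.symm h)]
      simp
  have e : #{j ∈ (range n).erase i | Function.update σ i l j = k} =
      #{j ∈ (range n).erase i | σ j = k} := by
    congr 1
    refine filter_congr fun j hj => ?_
    rw [Function.update_of_ne (ne_of_mem_erase hj)]
  rw [key σ, key (Function.update σ i l), e, Function.update_self]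
  omega

/-! ### Growing a tree of tight arcs. -/

/-- The state of a search for an augmenting path from `j₀`: `I k` is the robot visited in round `k`,
along the tight arc from label `J k`; `S` and `T` are the indicators of the labels reached and of
the robots visited. -/
structure Search (n m : ℕ) (A : ℕ → ℕ → ℕ) (σ : ℕ → ℕ) (j₀ : ℕ) (y z I J : ℕ → ℕ) (K : ℕ)
    (S T : ℕ → ℕ) : Prop where
  dual : Dual n m A σ y z
  reached : ∀ l ≤ m, S l ≠ 0 ↔ l = j₀ ∨ ∃ k < K, σ (I k) = l
  visited : ∀ i < n, T i ≠ 0 ↔ ∃ k < K, I k = i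
  robot_lt : ∀ k < K, I k < n
  one_le : ∀ k < K, 1 ≤ J k
  label_le : ∀ k < K, J k ≤ m
  inj : ∀ k < K, ∀ k' < k, I k' ≠ I k
  origin : ∀ k < K, J k = j₀ ∨ ∃ k' < k, σ (I k') = J k
  arc : ∀ k < K, A (I k) (J k) + z (I k) = y (J k)

variable {j₀ K : ℕ} {I J S T : ℕ → ℕ}

theorem Search.zero (h : Dual n m A σ y z) (hS : ∀ l ≤ m, S l ≠ 0 ↔ l = j₀)
    (hT : ∀ i < n, T i = 0) : Search n m A σ j₀ y z I J 0 S T where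
  dual := h
  reached l hl := by simp [hS l hl]
  visited i hi := by simp [hT i hi]
  robot_lt k hk := by omega
  one_le k hk := by omega
  label_le k hk := by omega
  inj k hk := by omega
  origin k hk := by omega
  arc k hk := by omega

/-- As long as label `0` is not reached, free robots are not visited. -/
theorem Search.not_visited (h : Search n m A σ j₀ y z I J K S T) (hS : S 0 = 0) {f : ℕ}
    (hf : f < n) (hσ : σ f = 0) : T f = 0 := by
  by_contra hT
  obtain ⟨k, hk, rfl⟩ := (h.visited f hf).1 hT
  exact (h.reached 0 (Nat.zero_le m)).2 (Or.inr ⟨k, hk, hσ⟩) hS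

/-- The visited robots are distinct and the free robot `f` is not among them. This is what bounds
the search by `n` rounds. -/
theorem Search.card_lt (h : Search n m A σ j₀ y z I J K S T) (hS : S 0 = 0) {f : ℕ}
    (hf : f < n) (hσ : σ f = 0) : K < n := by
  have hsub : (range K).image I ⊆ (range n).erase f := by
    intro i hi
    obtain ⟨k, hk, rfl⟩ := mem_image.1 hi
    have hk := mem_range.1 hk
    refine mem_erase.2 ⟨?_, mem_range.2 (h.robot_lt k hk)⟩
    rintro rfl
    exact (h.visited _ hf).2 ⟨k, hk, rfl⟩ (h.not_visited hS hf hσ)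
  have hinj : Set.InjOn I (range K) := by
    intro a ha b hb hab
    simp only [coe_range, Set.mem_Iio] at ha hb
    rcases lt_trichotomy a b with hlt | heq | hgt
    · exact absurd hab (h.inj b hb a hlt)
    · exact heq
    · exact absurd hab.symm (h.inj a ha b hgt)
  have := card_le_card hsub
  rw [card_image_of_injOn hinj, card_range, card_erase_of_mem (mem_range.2 hf), card_range] at this
  omega

/-- One round of the search: raise the potentials by the least slack `δ` of an arc that leaves the
search tree, and visit the robot `i` at the end of this arc. -/
theorem Search.step (h : Search n m A σ j₀ y z I J K S T) (hS : S 0 = 0) {i l δ : ℕ}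
    (hi : i < n) (hTi : T i = 0) (hl : 1 ≤ l) (hlm : l ≤ m) (hSl : S l ≠ 0)
    (hδ : A i l + z i = y l + δ)
    (hmin : ∀ i < n, T i = 0 → ∀ l, 1 ≤ l → l ≤ m → S l ≠ 0 → y l + δ ≤ A i l + z i)
    {y' z' : ℕ → ℕ}
    (hy : ∀ l, 1 ≤ l → l ≤ m → y' l = y l + if S l ≠ 0 then δ else 0)
    (hz : ∀ i < n, z' i = z i + if T i ≠ 0 then δ else 0) :
    Search n m A σ j₀ y' z' (Function.update I K i) (Function.update J K l) (K + 1)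
      (Function.update S (σ i) 1) (Function.update T i 1) := by
  have hTS : ∀ i < n, T i ≠ 0 → S (σ i) ≠ 0 := by
    intro i hi hT
    obtain ⟨k, hk, rfl⟩ := (h.visited i hi).1 hT
    exact (h.reached _ (h.dual.label_le _ hi)).2 (Or.inr ⟨k, hk, rfl⟩)
  have hold : ∀ k < K, Function.update I K i k = I k := fun k hk =>
    Function.update_of_ne hk.ne _ _
  have holdJ : ∀ k < K, Function.update J K l k = J k := fun k hk =>
    Function.update_of_ne hk.ne _ _
  have hex : ∀ P : ℕ → Prop, (∃ k < K + 1, P (Function.update I K i k)) ↔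
      (∃ k < K, P (I k)) ∨ P i := by
    intro P
    constructor
    · rintro ⟨k, hk, hP⟩
      rcases Nat.lt_succ_iff_lt_or_eq.1 hk with hk | rfl
      · exact Or.inl ⟨k, hk, by rwa [hold k hk] at hP⟩
      · exact Or.inr (by simpa using hP)
    · rintro (⟨k, hk, hP⟩ | hP)
      · exact ⟨k, by omega, by rwa [hold k hk]⟩
      · exact ⟨K, by omega, by simpa using hP⟩
  have hSJ : ∀ k < K, S (J k) ≠ 0 := by
    intro k hk
    refine (h.reached _ (h.label_le k hk)).2 ?_
    rcases h.origin k hk with h1 | ⟨k', hk', h1⟩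
    · exact Or.inl h1
    · exact Or.inr ⟨k', by omega, h1⟩
  refine ⟨⟨h.dual.label_le, ?_, ?_, ?_⟩, ?_, ?_, ?_, ?_, ?_, ?_, ?_, ?_⟩
  -- Only an arc from a reached label to an unvisited robot loses slack. It loses `δ`, which is at
  -- most its slack by minimality.
  · intro i hi l hl hlm
    rw [hy l hl hlm, hz i hi]
    have h1 := h.dual.feasible i hi l hl hlm
    have h2 := hmin i hi
    by_cases hT : T i = 0
    · by_cases hSl : S l = 0
      · simp [hT, hSl, h1]
      · simp [hT, hSl, h2 hT l hl hlm hSl]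
    · simp only [hT, ne_eq, not_false_eq_true, if_true]
      split_ifs <;> omega
  · intro i hi h0
    have hm := h.dual.label_le i hi
    have h1 := h.dual.tight i hi h0
    rw [hy _ (by omega) hm, hz i hi]
    by_cases hT : T i = 0
    · by_cases hS' : S (σ i) = 0
      · simp [hT, hS', h1]
      -- An unvisited robot whose own label is reached gives a tight arc out of the tree, so
      -- minimality forces `δ = 0`. Such a robot may be visited along the arc from its own label;
      -- moving it there later changes nothing.
      · have := hmin i hi hT _ (by omega) hm hS'
        simp [hT, hS']
        omega
    · simp [hT, hTS i hi hT]
      omega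
  · intro i hi h0
    rw [hz i hi, h.dual.free i hi h0, if_neg (by simp [h.not_visited hS hi h0])]
  · intro k hk
    rw [hex (fun j => σ j = k), ← or_assoc, ← h.reached k hk]
    by_cases hki : k = σ i
    · simp [hki]
    · simp [hki, Ne.symm hki]
  · intro k hk
    rw [hex (fun j => j = k), ← h.visited k hk]
    by_cases hki : k = i
    · simp [hki]
    · simp [hki, Ne.symm hki]
  · intro k hk
    rcases Nat.lt_succ_iff_lt_or_eq.1 hk with hk | rfl
    · rw [hold k hk]; exact h.robot_lt k hk
    · simpa using hi
  · intro k hk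
    rcases Nat.lt_succ_iff_lt_or_eq.1 hk with hk | rfl
    · rw [holdJ k hk]; exact h.one_le k hk
    · simpa using hl
  · intro k hk
    rcases Nat.lt_succ_iff_lt_or_eq.1 hk with hk | rfl
    · rw [holdJ k hk]; exact h.label_le k hk
    · simpa using hlm
  · intro k hk k' hk'
    rw [hold k' (by omega)]
    rcases Nat.lt_succ_iff_lt_or_eq.1 hk with hk | rfl
    · rw [hold k hk]; exact h.inj k hk k' hk'
    · rw [Function.update_self]
      rintro rfl
      exact (h.visited _ hi).2 ⟨k', hk', rfl⟩ hTi
  · intro k hk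
    have hc : ∀ k ≤ K, ∀ v, (∃ k' < k, σ (Function.update I K i k') = v) ↔
        ∃ k' < k, σ (I k') = v := by
      intro k hk v
      exact exists_congr fun k' => and_congr_right fun h' => by rw [hold k' (by omega)]
    rw [hc k (by omega)]
    rcases Nat.lt_succ_iff_lt_or_eq.1 hk with hk | rfl
    · rw [holdJ k hk]; exact h.origin k hk
    · rw [Function.update_self]; exact (h.reached l hlm).1 hSl
  · intro k hk
    rcases Nat.lt_succ_iff_lt_or_eq.1 hk with hk | rfl
    · rw [hold k hk, holdJ k hk, hy _ (h.one_le k hk) (h.label_le k hk), hz _ (h.robot_lt k hk)]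
      -- Both ends of a logged arc lie in the tree, so both potentials rise by `δ` and the arc stays
      -- tight.
      have hT := (h.visited _ (h.robot_lt k hk)).2 ⟨k, hk, rfl⟩
      have := h.arc k hk
      simp [hT, hSJ k hk]
      omega
    · simp only [Function.update_self]
      rw [hy l hl hlm, hz i hi]
      simp [hTi, hSl, hδ]

/-! ### Augmentation along the log. -/

/-- The backward scan of the search log. Initially label `c = 0` has one robot too many in comparison
with the target; the robots visited in rounds `k ≥ K` have been considered. -/
structure Scan (n m : ℕ) (A : ℕ → ℕ → ℕ) (σ : ℕ → ℕ) (j₀ : ℕ) (y z I : ℕ → ℕ) (K : ℕ)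
    (τ : ℕ → ℕ) (c : ℕ) : Prop where
  dual : Dual n m A τ y z
  same : ∀ k < K, τ (I k) = σ (I k)
  reached : c = j₀ ∨ ∃ k < K, σ (I k) = c
  count : ∀ l, count n τ l + (if l = 0 then 1 else 0) = count n σ l + if l = c then 1 else 0

theorem Search.scan (h : Search n m A σ j₀ y z I J K S T) (hS : S 0 ≠ 0) :
    Scan n m A σ j₀ y z I K σ 0 :=
  ⟨h.dual, fun _ _ => rfl, (h.reached 0 (Nat.zero_le m)).1 hS, fun _ => rfl⟩

variable {τ : ℕ → ℕ} {c k : ℕ}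

/-- The robot of round `k` still has its original label, so it is not the one through which `c` was
reached; an earlier round or `j₀` itself accounts for `c`. -/
theorem Scan.step_of_ne (h : Scan n m A σ j₀ y z I (k + 1) τ c) (hc : τ (I k) ≠ c) :
    Scan n m A σ j₀ y z I k τ c := by
  refine ⟨h.dual, fun k' hk' => h.same k' (by omega), ?_, h.count⟩
  rcases h.reached with h1 | ⟨k', hk', h1⟩
  · exact Or.inl h1
  · rcases Nat.lt_succ_iff_lt_or_eq.1 hk' with hk | rfl
    · exact Or.inr ⟨k', hk, h1⟩
    · exact absurd ((h.same _ hk').trans h1) hc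

/-- Moving the robot from `c` to `J k` passes the surplus on to a label reached before round `k`.
The arc is tight, so the potentials stay complementary, and since logged robots are distinct,
earlier ones keep their labels. -/
theorem Scan.step_of_eq (h : Scan n m A σ j₀ y z I (k + 1) τ c)
    (s : Search n m A σ j₀ y z I J K S T) (hk : k < K) (hc : τ (I k) = c) :
    Scan n m A σ j₀ y z I k (Function.update τ (I k) (J k)) (J k) := by
  have hi := s.robot_lt k hk
  have h1 := s.one_le k hk
  refine ⟨⟨?_, h.dual.feasible, ?_, ?_⟩, ?_, s.origin k hk, ?_⟩
  · intro i hi'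
    by_cases hik : i = I k
    · subst hik; simpa using s.label_le k hk
    · simpa [hik] using h.dual.label_le i hi'
  · intro i hi'
    by_cases hik : i = I k
    · subst hik; simpa using fun _ => s.arc k hk
    · simpa [hik] using h.dual.tight i hi'
  · intro i hi'
    by_cases hik : i = I k
    · subst hik; simp only [Function.update_self]; omega
    · simpa [hik] using h.dual.free i hi'
  · intro k' hk'
    rw [Function.update_of_ne (s.inj k hk k' hk')]
    exact h.same k' (by omega)
  · intro l
    have h2 := count_update (σ := τ) (l := J k) hi l
    have h3 := h.count l
    rw [hc] at h2
    omega

theorem Scan.reached_zero (h : Scan n m A σ j₀ y z I 0 τ c) : c = j₀ := by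
  rcases h.reached with h1 | ⟨k', hk', -⟩
  · exact h1
  · omega

/-- `(i, l)` attains the least value `v` of `f` over the pairs satisfying `P`, or there are none and
`b = 0`. -/
def IsArgmin (P : ℕ → ℕ → Prop) (f : ℕ → ℕ → ℕ) (b v i l : ℕ) : Prop :=
  (b = 0 → ∀ i l, ¬ P i l) ∧ (b ≠ 0 → P i l ∧ v = f i l ∧ ∀ i' l', P i' l' → v ≤ f i' l')

end Assignment

/-! ### The program

The arrays are: `1` the input, `2` a common denominator of the costs, `3` the labels, `4` and `5`
the potentials of the labels and of the robots, `6` and `7` the labels reached and the robots visited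
by a search, `8` and `9` its log and `10` the length of the log, `11` the current label of the
backward scan, `12`, `13`, `14` the least slack with its robot and label, `15` whether there is one,
`20` to `24` the loop counters. -/

namespace Assignment

open Ram Ram.Prog

/-- The address of the numerator of the cost of robot `i` for label `l`. -/
def address (m i l : ℕ) : ℕ := 1 + m + (i * m + (i * m + i)) + (l + l)

/-- The cost of robot `i` for label `l` times the common denominator `d`. -/
def arcCost (w : ℕ → ℕ) (d i l : ℕ) : ℕ :=
  d / w (address (w 1) i l + 1) * w (address (w 1) i l)

def var (a : ℕ) : Expr := .get a (.lit 0)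

def succE (e : Expr) : Expr := .op .add e (.lit 1)

/-- The multiple `i * (2 * m + 1)` is spelled out as a sum, because `Tame` permits multiplication
only by a cell of the input. -/
def addressE (i l : Expr) : Expr :=
  .op .add (.op .add (.op .add (.lit 1) (.get 1 (.lit 1)))
    (.op .add (.op .mul i (.get 1 (.lit 1))) (.op .add (.op .mul i (.get 1 (.lit 1))) i)))
    (.op .add l l)

/-- Dividing before multiplying makes the second factor an input cell, as `Tame` requires. -/
def arcCostE (i l : Expr) : Expr :=
  .op .mul (.op .div (var 2) (.get 1 (succE (addressE i l)))) (.get 1 (addressE i l))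

/-- Non-zero if and only if the two values differ. -/
def neE (e₁ e₂ : Expr) : Expr := .op .add (.op .lt e₁ e₂) (.op .lt e₂ e₁)

@[simp] theorem eval_var (a : ℕ) (s : Store) : (var a).eval s = s a 0 := rfl

@[simp] theorem eval_succE (e : Expr) (s : Store) : (succE e).eval s = e.eval s + 1 := rfl

theorem eval_addressE (i l : Expr) (s : Store) :
    (addressE i l).eval s = address (s 1 1) (i.eval s) (l.eval s) := rfl

@[simp] theorem eval_arcCostE (i l : Expr) (s : Store) :
    (arcCostE i l).eval s = arcCost (s 1) (s 2 0) (i.eval s) (l.eval s) := rfl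

@[simp] theorem eval_neE (e₁ e₂ : Expr) (s : Store) :
    (neE e₁ e₂).eval s = 0 ↔ e₁.eval s = e₂.eval s := by
  rcases lt_trichotomy (e₁.eval s) (e₂.eval s) with h | h | h
  · simp [neE, Expr.eval, Op.eval, h, h.ne]
  · simp [neE, Expr.eval, Op.eval, h]
  · simp [neE, Expr.eval, Op.eval, h, h.ne']

/-- Loops that assign a new value to each cell of a range. -/
theorem den_forLoop_map {x a k N : ℕ} {p : Prog} {s : Store} (b o : ℕ) (g : ℕ → ℕ)
    (hN : s a k = N) (hb : b ≠ x)
    (step : ∀ i < N, ∀ t : Store, (∀ c, c ∉ (forLoop x a k p).writes → t c = s c) →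
      t b (i + o) = s b (i + o) →
      ∀ j, p.den (t.write x 0 i) b j = if j = i + o then g i else t b j) (j : ℕ) :
    (forLoop x a k p).den s b j = if o ≤ j ∧ j < N + o then g (j - o) else s b j := by
  refine forLoop_inv (fun i t => ∀ j, t b j = if o ≤ j ∧ j < i + o then g (j - o) else s b j) hN
    (fun j => ?_) (fun i hi t ht hP j => ?_) (fun t v hP j => ?_) j
  · rw [if_neg (by omega)]
  · rw [step i hi t ht (by rw [hP, if_neg (by omega)])]
    split_ifs with h1 h2 h2
    · rw [h1, Nat.add_sub_cancel]
    · omega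
    · rw [hP, if_pos (by omega)]
    · rw [hP, if_neg (by omega)]
  · rw [Store.write_of_ne _ hb]
    exact hP j

/-! #### The common denominator -/

/-- The product of all denominators suffices: its bit length is polynomial in the input size, and no
greatest common divisors are needed. -/
def denominator : Prog :=
  seq (assign 2 (.lit 0) (.lit 1))
    (forLoop 23 1 0 (forLoop 24 1 1
      (assign 2 (.lit 0) (.op .mul (var 2) (.get 1 (succE (addressE (var 23) (succE (var 24)))))))))

theorem den_denominator (s : Store)
    (hpos : ∀ i < s 1 0, ∀ l, 1 ≤ l → l ≤ s 1 1 → s 1 (address (s 1 1) i l + 1) ≠ 0) :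
    (denominator.den s) 2 0 ≠ 0 ∧
      ∀ i < s 1 0, ∀ l, 1 ≤ l → l ≤ s 1 1 →
        s 1 (address (s 1 1) i l + 1) ∣ (denominator.den s) 2 0 := by
  refine forLoop_inv (fun i t => t 2 0 ≠ 0 ∧ ∀ i' < i, ∀ l, 1 ≤ l → l ≤ s 1 1 →
    s 1 (address (s 1 1) i' l + 1) ∣ t 2 0) (by simp [den]) ?_ ?_ ?_
  · simp [den, Expr.eval]
  · intro i hi t ht hP
    have h1 : t 1 = s 1 := (ht 1 (by simp [writes])).trans (by simp [den])
    have := forLoop_inv (x := 24) (a := 1) (k := 1) (N := s 1 1)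
      (p := assign 2 (.lit 0)
        (.op .mul (var 2) (.get 1 (succE (addressE (var 23) (succE (var 24)))))))
      (s := t.write 23 0 i) (fun l t => t 2 0 ≠ 0 ∧ (∀ i' < i, ∀ l, 1 ≤ l → l ≤ s 1 1 →
        s 1 (address (s 1 1) i' l + 1) ∣ t 2 0) ∧
        ∀ l', 1 ≤ l' → l' ≤ l → s 1 (address (s 1 1) i l' + 1) ∣ t 2 0) (by simp [h1]) ?_ ?_ ?_
    · refine ⟨this.1, fun i' hi' l hl hlm => ?_⟩
      rcases Nat.lt_succ_iff_lt_or_eq.1 hi' with h | rfl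
      · exact this.2.1 i' h l hl hlm
      · exact this.2.2 l hl hlm
    · refine ⟨by simpa using hP.1, by simpa using hP.2, by omega⟩
    · intro l hl u hu hQ
      have h1u : u 1 = s 1 := (hu 1 (by simp [writes])).trans (by simp [h1])
      have h23 : u 23 0 = i := by rw [hu 23 (by simp [writes])]; simp
      have hv : (Prog.den (assign 2 (.lit 0)
          (.op .mul (var 2) (.get 1 (succE (addressE (var 23) (succE (var 24)))))))
          (u.write 24 0 l)) 2 0 = u 2 0 * s 1 (address (s 1 1) i (l + 1) + 1) := by
        simp [den, Expr.eval, Op.eval, eval_addressE, h1u, h23]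
      rw [hv]
      refine ⟨mul_ne_zero hQ.1 (hpos i hi _ (by omega) (by omega)),
        fun i' hi' l' hl' hlm' => (hQ.2.1 i' hi' l' hl' hlm').mul_right _, fun l' hl' hll' => ?_⟩
      rcases Nat.le_succ_iff.1 hll' with h | rfl
      · exact (hQ.2.2 l' hl' h).mul_right _
      · exact dvd_mul_left _ _
    · intro u v hQ
      simpa using hQ
  · intro t v hP
    simpa using hP

/-! #### The least slack -/

theorem IsArgmin.take {P Q : ℕ → ℕ → Prop} {f : ℕ → ℕ → ℕ} {b v i l a c : ℕ}
    (h : IsArgmin P f b v i l) (hQ : ∀ i' l', Q i' l' ↔ P i' l' ∨ i' = a ∧ l' = c)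
    (hv : b = 0 ∨ f a c < v) : IsArgmin Q f 1 (f a c) a c := by
  refine ⟨by omega, fun _ => ⟨(hQ _ _).2 (Or.inr ⟨rfl, rfl⟩), rfl, fun i' l' hq => ?_⟩⟩
  rcases (hQ _ _).1 hq with hp | ⟨rfl, rfl⟩
  · by_cases hb : b = 0
    · exact absurd hp (h.1 hb i' l')
    · have := (h.2 hb).2.2 i' l' hp
      omega
  · exact le_rfl

theorem IsArgmin.keep {P Q : ℕ → ℕ → Prop} {f : ℕ → ℕ → ℕ} {b v i l a c : ℕ}
    (h : IsArgmin P f b v i l) (hQ : ∀ i' l', Q i' l' ↔ P i' l' ∨ i' = a ∧ l' = c)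
    (hb : b ≠ 0) (hv : v ≤ f a c) : IsArgmin Q f b v i l := by
  obtain ⟨h1, h2, h3⟩ := h.2 hb
  refine ⟨fun h0 => absurd h0 hb, fun _ => ⟨(hQ _ _).2 (Or.inl h1), h2, fun i' l' hq => ?_⟩⟩
  rcases (hQ _ _).1 hq with hp | ⟨rfl, rfl⟩
  · exact h3 i' l' hp
  · exact hv

theorem IsArgmin.congr {P Q : ℕ → ℕ → Prop} {f : ℕ → ℕ → ℕ} {b v i l : ℕ}
    (h : IsArgmin P f b v i l) (hQ : ∀ i' l', Q i' l' ↔ P i' l') : IsArgmin Q f b v i l := by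
  obtain rfl : Q = P := by funext i l; exact propext (hQ i l)
  exact h

/-- The slack of the arc from label `l + 1` to robot `i`, for the counters `i` and `l`. -/
def slackE : Expr :=
  .op .sub (.op .add (arcCostE (var 23) (succE (var 24))) (.get 5 (var 23)))
    (.get 4 (succE (var 24)))

def leastSlackInner : Prog :=
  forLoop 24 1 1 (cond (.get 6 (succE (var 24)))
    (cond (.op .add (.op .lt (var 15) (.lit 1)) (.op .lt slackE (var 12)))
      (seq (assign 12 (.lit 0) slackE) (seq (assign 13 (.lit 0) (var 23))
        (seq (assign 14 (.lit 0) (succE (var 24))) (assign 15 (.lit 0) (.lit 1))))) skip) skip)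

def leastSlack : Prog :=
  seq (assign 15 (.lit 0) (.lit 0))
    (forLoop 23 1 0 (cond (.get 7 (var 23)) skip leastSlackInner))

/-- Dual feasibility makes the truncated subtraction exact where it is used. -/
def slack (s : Store) (i l : ℕ) : ℕ := arcCost (s 1) (s 2 0) i l + s 5 i - s 4 l

/-- `P` stands for the arcs of the robots examined earlier in the outer loop. -/
theorem den_leastSlackInner {s : Store} {i : ℕ} (hi : s 23 0 = i) {P : ℕ → ℕ → Prop}
    (h : IsArgmin P (slack s) (s 15 0) (s 12 0) (s 13 0) (s 14 0)) :
    let t := leastSlackInner.den s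
    IsArgmin (fun i' l' => P i' l' ∨ i' = i ∧ 1 ≤ l' ∧ l' ≤ s 1 1 ∧ s 6 l' ≠ 0) (slack s)
      (t 15 0) (t 12 0) (t 13 0) (t 14 0) := by
  refine forLoop_inv (fun l t => IsArgmin (fun i' l' => P i' l' ∨ i' = i ∧ 1 ≤ l' ∧ l' ≤ l ∧
    s 6 l' ≠ 0) (slack s) (t 15 0) (t 12 0) (t 13 0) (t 14 0)) rfl ?_ ?_ ?_
  · exact h.congr fun i' l' => ⟨fun h => h.resolve_right (by omega), Or.inl⟩
  · intro l hl t ht hQ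
    have h1 : t 1 = s 1 := ht 1 (by simp [writes])
    have h2 : t 2 = s 2 := ht 2 (by simp [writes])
    have h4 : t 4 = s 4 := ht 4 (by simp [writes])
    have h5 : t 5 = s 5 := ht 5 (by simp [writes])
    have h6 : t 6 = s 6 := ht 6 (by simp [writes])
    have h23 : t 23 0 = i := by rw [ht 23 (by simp [writes]), hi]
    have hsl : slackE.eval (t.write 24 0 l) = slack s i (l + 1) := by
      simp [slackE, slack, Expr.eval, Op.eval, h1, h2, h4, h5, h23]
    by_cases hS : s 6 (l + 1) = 0
    · have : (Expr.get 6 (succE (var 24))).eval (t.write 24 0 l) = 0 := by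
        simp [Expr.eval, h6, hS]
      rw [den, if_neg (not_not.2 this)]
      have hv : ∀ a ≠ 24, Prog.den skip (t.write 24 0 l) a = t a := fun a ha => by
        rw [den, Store.write_of_ne _ ha]
      rw [hv 15 (by simp), hv 12 (by simp), hv 13 (by simp), hv 14 (by simp)]
      refine hQ.congr fun i' l' => or_congr_right (and_congr_right fun _ => and_congr_right fun _ =>
        ⟨fun ⟨a, b⟩ => ⟨?_, b⟩, fun ⟨a, b⟩ => ⟨by omega, b⟩⟩)
      rcases Nat.le_succ_iff.1 a with a | rfl
      · exact a
      · exact absurd hS b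
    · have : (Expr.get 6 (succE (var 24))).eval (t.write 24 0 l) ≠ 0 := by
        simp [Expr.eval, h6, hS]
      have hiff : ∀ i' l', (P i' l' ∨ i' = i ∧ 1 ≤ l' ∧ l' ≤ l + 1 ∧ s 6 l' ≠ 0) ↔
          (P i' l' ∨ i' = i ∧ 1 ≤ l' ∧ l' ≤ l ∧ s 6 l' ≠ 0) ∨ i' = i ∧ l' = l + 1 := by
        intro i' l'
        rw [or_assoc]
        refine or_congr_right ?_
        rw [← and_or_left]
        refine and_congr_right fun _ => ⟨fun ⟨a, b, c⟩ => ?_, ?_⟩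
        · rcases Nat.le_succ_iff.1 b with b | b
          · exact Or.inl ⟨a, b, c⟩
          · exact Or.inr b
        · rintro (⟨a, b, c⟩ | rfl)
          · exact ⟨a, by omega, c⟩
          · exact ⟨by omega, le_rfl, hS⟩
      rw [den, if_pos this]
      have hc : (Expr.op .add (.op .lt (var 15) (.lit 1)) (.op .lt slackE (var 12))).eval
          (t.write 24 0 l) ≠ 0 ↔ t 15 0 = 0 ∨ slack s i (l + 1) < t 12 0 := by
        have hv : ∀ a ≠ 24, (t.write 24 0 l) a 0 = t a 0 := fun a ha => by
          rw [Store.write_of_ne _ ha]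
        simp only [Expr.eval, hsl, eval_var, Op.eval, hv 15 (by simp), hv 12 (by simp)]
        by_cases h15 : t 15 0 = 0 <;> by_cases h12 : slack s i (l + 1) < t 12 0 <;>
          simp [h15, h12]
      rw [den]
      split_ifs with hcond
      · have := hQ.take hiff (hc.1 hcond)
        simpa [den, hsl, h23, Expr.eval] using this
      · have hn := (not_congr hc).1 hcond
        rw [not_or, not_lt] at hn
        simpa [den] using hQ.keep hiff hn.1 hn.2
  · intro t v hQ
    simpa using hQ

theorem den_leastSlack (s : Store) :
    let t := leastSlack.den s
    IsArgmin (fun i l => i < s 1 0 ∧ s 7 i = 0 ∧ 1 ≤ l ∧ l ≤ s 1 1 ∧ s 6 l ≠ 0) (slack s)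
      (t 15 0) (t 12 0) (t 13 0) (t 14 0) := by
  refine forLoop_inv (fun k t => IsArgmin (fun i l => i < k ∧ s 7 i = 0 ∧ 1 ≤ l ∧ l ≤ s 1 1 ∧
    s 6 l ≠ 0) (slack s) (t 15 0) (t 12 0) (t 13 0) (t 14 0)) (by simp [den]) ?_ ?_ ?_
  · exact ⟨by simp, by simp [den, Expr.eval]⟩
  · intro i hi t ht hP
    have hfr : ∀ a ∈ [1, 2, 4, 5, 6, 7], t a = s a := by
      intro a ha
      simp only [List.mem_cons, List.not_mem_nil, or_false] at ha
      rcases ha with rfl | rfl | rfl | rfl | rfl | rfl <;>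
        exact (ht _ (by simp [writes, leastSlackInner])).trans (by simp [den])
    have hsl : slack (t.write 23 0 i) = slack s := by
      funext a b
      simp [slack, hfr]
    rw [den]
    split_ifs with hT
    · replace hT : s 7 i ≠ 0 := by simpa [Expr.eval, hfr] using hT
      have hv : ∀ a ≠ 23, Prog.den skip (t.write 23 0 i) a = t a := fun a ha => by
        rw [den, Store.write_of_ne _ ha]
      rw [hv 15 (by simp), hv 12 (by simp), hv 13 (by simp), hv 14 (by simp)]
      refine hP.congr fun i' l' => ⟨fun ⟨a, b⟩ => ⟨?_, b⟩, fun ⟨a, b⟩ => ⟨by omega, b⟩⟩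
      rcases Nat.lt_succ_iff_lt_or_eq.1 a with a | rfl
      · exact a
      · exact absurd b.1 hT
    · replace hT : s 7 i = 0 := by simpa [Expr.eval, hfr] using hT
      have := den_leastSlackInner (s := t.write 23 0 i) (i := i) (by simp)
        (P := fun i' l => i' < i ∧ s 7 i' = 0 ∧ 1 ≤ l ∧ l ≤ s 1 1 ∧ s 6 l ≠ 0)
        (by rw [hsl]; simpa using hP)
      rw [hsl] at this
      refine this.congr fun i' l' => ?_
      rw [Store.write_of_ne t (show 1 ≠ 23 by simp), Store.write_of_ne t (show 6 ≠ 23 by simp),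
        hfr 1 (by simp), hfr 6 (by simp)]
      constructor
      · rintro ⟨a, b⟩
        rcases Nat.lt_succ_iff_lt_or_eq.1 a with a | rfl
        · exact Or.inl ⟨a, b⟩
        · exact Or.inr ⟨rfl, b.2⟩
      · rintro (⟨a, b⟩ | ⟨rfl, b⟩)
        · exact ⟨by omega, b⟩
        · exact ⟨by omega, hT, b⟩
  · intro t v hP
    simpa using hP

end Assignment

namespace Assignment

open Ram Ram.Prog

/-! #### The search -/

def raiseLabels : Prog :=
  forLoop 24 1 1 (cond (.get 6 (succE (var 24)))
    (assign 4 (succE (var 24)) (.op .add (.get 4 (succE (var 24))) (var 12))) skip)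

def raiseRobots : Prog :=
  forLoop 23 1 0 (cond (.get 7 (var 23))
    (assign 5 (var 23) (.op .add (.get 5 (var 23)) (var 12))) skip)

def visit : Prog :=
  seq (assign 8 (var 10) (var 13)) (seq (assign 9 (var 10) (var 14))
    (seq (assign 10 (.lit 0) (succE (var 10)))
      (seq (assign 6 (.get 3 (var 13)) (.lit 1)) (assign 7 (var 13) (.lit 1)))))

/-- Once a free robot is met, that is, label `0` is reached, the remaining rounds idle; hence the
loop can have the fixed bound `n`. -/
def searchRound : Prog :=
  cond (.get 6 (.lit 0)) skip (seq leastSlack (seq raiseLabels (seq raiseRobots visit)))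

theorem den_raiseLabels (s : Store) {l : ℕ} (hl : 1 ≤ l) (hlm : l ≤ s 1 1) :
    (raiseLabels.den s) 4 l = s 4 l + if s 6 l ≠ 0 then s 12 0 else 0 := by
  have := den_forLoop_map (x := 24) (a := 1) (k := 1) (s := s)
    (p := cond (.get 6 (succE (var 24)))
      (assign 4 (succE (var 24)) (.op .add (.get 4 (succE (var 24))) (var 12))) skip) 4 1
    (fun i => s 4 (i + 1) + if s 6 (i + 1) ≠ 0 then s 12 0 else 0) rfl (by simp) ?_ l
  · rw [if_pos (by omega), Nat.sub_add_cancel hl] at this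
    exact this
  · intro i hi t ht h4 j
    have h6 : t 6 = s 6 := ht 6 (by simp [writes])
    have h12 : t 12 = s 12 := ht 12 (by simp [writes])
    by_cases h : s 6 (i + 1) = 0
    · simp only [den, Expr.eval, eval_succE, eval_var]
      by_cases hj : j = i + 1
      · subst hj; simp [h6, h, h4]
      · simp [h6, h, hj]
    · by_cases hj : j = i + 1
      · subst hj; simp [den, Expr.eval, Op.eval, h6, h, h4, h12]
      · simp [den, Expr.eval, Op.eval, h6, h, hj]

theorem den_raiseRobots (s : Store) {i : ℕ} (hi : i < s 1 0) :
    (raiseRobots.den s) 5 i = s 5 i + if s 7 i ≠ 0 then s 12 0 else 0 := by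
  have := den_forLoop_map (x := 23) (a := 1) (k := 0) (s := s)
    (p := cond (.get 7 (var 23))
      (assign 5 (var 23) (.op .add (.get 5 (var 23)) (var 12))) skip) 5 0
    (fun i => s 5 i + if s 7 i ≠ 0 then s 12 0 else 0) rfl (by simp) ?_ i
  · rw [if_pos (by omega)] at this
    exact this
  · intro i hi t ht h5 j
    have h7 : t 7 = s 7 := ht 7 (by simp [writes])
    have h12 : t 12 = s 12 := ht 12 (by simp [writes])
    rw [add_zero] at h5
    by_cases h : s 7 i = 0
    · by_cases hj : j = i
      · subst hj; simp [den, Expr.eval, h7, h, h5]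
      · simp [den, Expr.eval, h7, h, hj]
    · by_cases hj : j = i
      · subst hj; simp [den, Expr.eval, Op.eval, h7, h, h5, h12]
      · simp [den, Expr.eval, Op.eval, h7, h, hj]

/-- The store describes a search from label `j₀`, for `s 1 0` robots and `s 1 1` tasks. -/
def IsSearch (j₀ : ℕ) (s : Store) : Prop :=
  Search (s 1 0) (s 1 1) (arcCost (s 1) (s 2 0)) (s 3) j₀ (s 4) (s 5) (s 8) (s 9) (s 10 0) (s 6)
    (s 7)

theorem den_searchRound_of_ne {s : Store} (hS : s 6 0 ≠ 0) : searchRound.den s = s := by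
  simp [searchRound, den, Expr.eval, hS]

theorem den_searchRound {s : Store} {j₀ f : ℕ} (h : IsSearch j₀ s) (hj : 1 ≤ j₀)
    (hjm : j₀ ≤ s 1 1) (hf : f < s 1 0) (hσ : s 3 f = 0) (hS : s 6 0 = 0) :
    IsSearch j₀ (searchRound.den s) ∧ (searchRound.den s) 10 0 = s 10 0 + 1 := by
  have hd : searchRound.den s =
      visit.den (raiseRobots.den (raiseLabels.den (leastSlack.den s))) := by
    simp [searchRound, den, Expr.eval, hS]
  rw [hd]
  have hmin := den_leastSlack s
  have f1 : ∀ a, a ∉ leastSlack.writes → (leastSlack.den s) a = s a :=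
    fun a ha => den_frame _ ha s
  revert hmin f1
  generalize leastSlack.den s = s₁
  intro hmin f1
  -- The arc from `j₀` to the unvisited free robot `f` leaves the tree, so a least slack exists.
  have hb : s₁ 15 0 ≠ 0 := fun hb => hmin.1 hb f j₀
    ⟨hf, h.not_visited hS hf hσ, hj, hjm, (h.reached j₀ hjm).2 (Or.inl rfl)⟩
  obtain ⟨⟨hi, hTi, hl, hlm, hSl⟩, hv, hle⟩ := hmin.2 hb
  have g : ∀ a ∈ [1, 2, 3, 4, 5, 6, 7, 8, 9, 10], s₁ a = s a := by
    intro a ha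
    refine f1 a fun hw => ?_
    simp only [leastSlack, leastSlackInner, writes, List.mem_cons, List.not_mem_nil, or_false,
      List.append_nil, List.nil_append, List.cons_append] at hw ha
    omega
  have hy : ∀ l, 1 ≤ l → l ≤ s 1 1 → (raiseLabels.den s₁) 4 l =
      s 4 l + if s 6 l ≠ 0 then s₁ 12 0 else 0 := by
    intro l hl hlm
    rw [den_raiseLabels s₁ hl (by rwa [g 1 (by simp)]), g 4 (by simp), g 6 (by simp)]
  have f2 : ∀ a, a ∉ raiseLabels.writes → (raiseLabels.den s₁) a = s₁ a :=
    fun a ha => den_frame _ ha s₁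
  revert hy f2
  generalize raiseLabels.den s₁ = s₂
  intro hy f2
  have g2 : ∀ a ∈ [1, 2, 3, 5, 6, 7, 8, 9, 10, 12, 13, 14], s₂ a = s₁ a := by
    intro a ha
    refine f2 a fun hw => ?_
    simp only [raiseLabels, writes, List.mem_cons, List.not_mem_nil, or_false,
      List.append_nil] at hw ha
    omega
  have hz : ∀ i < s 1 0, (raiseRobots.den s₂) 5 i =
      s 5 i + if s 7 i ≠ 0 then s₁ 12 0 else 0 := by
    intro i hi
    rw [den_raiseRobots s₂ (by rwa [g2 1 (by simp), g 1 (by simp)]), g2 5 (by simp),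
      g2 7 (by simp), g2 12 (by simp), g 5 (by simp), g 7 (by simp)]
  have f3 : ∀ a, a ∉ raiseRobots.writes → (raiseRobots.den s₂) a = s₂ a :=
    fun a ha => den_frame _ ha s₂
  revert hz f3
  generalize raiseRobots.den s₂ = s₃
  intro hz f3
  have g3 : ∀ a ∈ [1, 2, 3, 4, 6, 7, 8, 9, 10, 12, 13, 14], s₃ a = s₂ a := by
    intro a ha
    refine f3 a fun hw => ?_
    simp only [raiseRobots, writes, List.mem_cons, List.not_mem_nil, or_false,
      List.append_nil] at hw ha
    omega
  have e : ∀ a ∈ [1, 2, 3, 6, 7, 8, 9, 10], s₃ a = s a := by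
    intro a ha
    rw [g3 a, g2 a, g a]
    all_goals
      simp only [List.mem_cons, List.not_mem_nil, or_false] at ha ⊢
      omega
  have e' : ∀ a ∈ [13, 14], s₃ a = s₁ a := by
    intro a ha
    rw [g3 a, g2 a]
    all_goals
      simp only [List.mem_cons, List.not_mem_nil, or_false] at ha ⊢
      omega
  have hy' : ∀ l, 1 ≤ l → l ≤ s 1 1 → s₃ 4 l = s 4 l + if s 6 l ≠ 0 then s₁ 12 0 else 0 := by
    rw [g3 4 (by simp)]; exact hy
  have key := Search.step h hS hi hTi hl hlm hSl (δ := s₁ 12 0)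
    (by rw [hv]; have := h.dual.feasible _ hi _ hl hlm; simp only [slack]; omega)
    (by
      intro i hi hT l hl hlm hS
      have h1 := hle i l ⟨hi, hT, hl, hlm, hS⟩
      have h2 := h.dual.feasible _ hi _ hl hlm
      simp only [slack] at h1
      omega) hy' hz
  simpa [IsSearch, visit, den, Expr.eval, e 1 (by simp), e 2 (by simp), e 3 (by simp),
    e 6 (by simp), e 7 (by simp), e 8 (by simp), e 9 (by simp), e 10 (by simp), e' 13 (by simp),
    e' 14 (by simp)] using key

def clearLabels : Prog := forLoop 24 1 1 (assign 6 (succE (var 24)) (.lit 0))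

def clearRobots : Prog := forLoop 23 1 0 (assign 7 (var 23) (.lit 0))

/-- Start a search from the label that exceeds cell `0` of array `20` by one. -/
def startSearch : Prog :=
  seq clearLabels (seq clearRobots (seq (assign 6 (.lit 0) (.lit 0))
    (seq (assign 6 (succE (var 20)) (.lit 1)) (assign 10 (.lit 0) (.lit 0)))))

theorem den_startSearch {s : Store}
    (h : Dual (s 1 0) (s 1 1) (arcCost (s 1) (s 2 0)) (s 3) (s 4) (s 5)) :
    IsSearch (s 20 0 + 1) (startSearch.den s) ∧ (startSearch.den s) 10 0 = 0 := by
  have h6 := den_forLoop_map (x := 24) (a := 1) (k := 1) (s := s)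
    (p := assign 6 (succE (var 24)) (.lit 0)) 6 1 (fun _ => 0) rfl (by simp)
    (fun i hi t _ _ j => by simp [den, Expr.eval, Function.update_apply])
  have f1 : ∀ a, a ∉ clearLabels.writes → (clearLabels.den s) a = s a :=
    fun a ha => den_frame _ ha s
  simp only [startSearch, den]
  change ∀ j, (clearLabels.den s) 6 j = _ at h6
  revert h6 f1
  generalize clearLabels.den s = s₁
  intro f1 h6
  simp only [clearLabels, writes, List.mem_cons, List.not_mem_nil, or_false, not_or] at f1
  have h7 := den_forLoop_map (x := 23) (a := 1) (k := 0) (s := s₁)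
    (p := assign 7 (var 23) (.lit 0)) 7 0 (fun _ => 0) rfl (by simp)
    (fun i hi t _ _ j => by simp [den, Expr.eval, Function.update_apply])
  have f2 : ∀ a, a ∉ clearRobots.writes → (clearRobots.den s₁) a = s₁ a :=
    fun a ha => den_frame _ ha s₁
  change ∀ j, (clearRobots.den s₁) 7 j = _ at h7
  revert h7 f2
  generalize clearRobots.den s₁ = s₂
  intro f2 h7
  simp only [clearRobots, writes, List.mem_cons, List.not_mem_nil, or_false, not_or] at f2
  have e : ∀ a, a ≠ 23 → a ≠ 24 → a ≠ 6 → a ≠ 7 → s₂ a = s a := fun a h1 h2 h3 h4 => by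
    rw [f2 a ⟨h1, h4⟩, f1 a ⟨h2, h3⟩]
  refine ⟨?_, by simp [Expr.eval]⟩
  have e6 : s₂ 6 = s₁ 6 := f2 6 (by simp)
  simp only [IsSearch, Expr.eval, eval_succE, eval_var]
  simp [e]
  refine Search.zero h (fun l hl => ?_) (fun i hi => ?_)
  · by_cases hl' : l = s 20 0 + 1
    · simp [hl']
    · by_cases hl0 : l = 0
      · simp [hl0]
      · rw [Function.update_of_ne hl', Function.update_of_ne hl0, e6, h6, if_pos (by omega)]
        simp [hl']
  · rw [h7, if_pos ⟨by omega, by rwa [f1 1 (by simp)]⟩]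

def search : Prog := seq startSearch (forLoop 22 1 0 searchRound)

theorem den_search {s : Store}
    (h : Dual (s 1 0) (s 1 1) (arcCost (s 1) (s 2 0)) (s 3) (s 4) (s 5)) {f : ℕ}
    (hj : s 20 0 < s 1 1) (hf : f < s 1 0) (hσ : s 3 f = 0) :
    IsSearch (s 20 0 + 1) (search.den s) ∧ (search.den s) 6 0 ≠ 0 ∧
      (search.den s) 10 0 ≤ s 1 0 := by
  obtain ⟨h1, h2⟩ := den_startSearch h
  have f1 : ∀ a, a ∉ startSearch.writes → (startSearch.den s) a = s a :=
    fun a ha => den_frame _ ha s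
  rw [search, den]
  revert h1 h2 f1
  generalize startSearch.den s = s₁
  intro h1 h2 f1
  simp only [startSearch, clearLabels, clearRobots, writes, List.mem_cons, List.not_mem_nil,
    or_false, not_or, List.nil_append, List.cons_append] at f1
  have e1 : s₁ 1 = s 1 := f1 1 (by simp)
  have e3 : s₁ 3 = s 3 := f1 3 (by simp)
  -- While label `0` is unreached, every round lengthens the log by exactly one. Were it unreached
  -- after `n` rounds, the log would have length `n`, against `Search.card_lt`.
  have key := forLoop_inv (x := 22) (a := 1) (k := 0) (N := s 1 0) (p := searchRound) (s := s₁)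
    (fun i t => IsSearch (s 20 0 + 1) t ∧ t 10 0 ≤ i ∧ (t 6 0 = 0 → t 10 0 = i))
    (by rw [e1]) ⟨h1, h2.le, fun _ => h2⟩ ?_ ?_
  · have f2 : ∀ a ∈ [1, 3], (forLoop 22 1 0 searchRound).den s₁ a = s a := by
      intro a ha
      rw [den_frame, f1]
      · simp only [List.mem_cons, List.not_mem_nil, or_false] at ha
        omega
      · simp only [List.mem_cons, List.not_mem_nil, or_false] at ha
        simp only [searchRound, leastSlack, leastSlackInner, raiseLabels, raiseRobots, visit,
          writes, List.mem_cons, List.not_mem_nil, or_false, not_or, List.append_nil,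
          List.nil_append, List.cons_append]
        omega
    obtain ⟨k1, k2, k3⟩ := key
    refine ⟨k1, fun hS => ?_, k2⟩
    have := k1.card_lt hS (f := f) (by rwa [f2 1 (by simp)]) (by rw [f2 3 (by simp)]; exact hσ)
    rw [k3 hS, f2 1 (by simp)] at this
    omega
  · intro i hi t ht hP
    have hw : IsSearch (s 20 0 + 1) (t.write 22 0 i) := by simpa [IsSearch] using hP.1
    have t1 : t 1 = s 1 := by
      rw [ht 1 (by simp [searchRound, leastSlack, leastSlackInner, raiseLabels, raiseRobots, visit,
        writes]), e1]
    have t3 : t 3 = s 3 := by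
      rw [ht 3 (by simp [searchRound, leastSlack, leastSlackInner, raiseLabels, raiseRobots, visit,
        writes]), e3]
    by_cases hS : t 6 0 = 0
    · obtain ⟨k1, k2⟩ := den_searchRound hw (by omega) (f := f) (by simpa [t1] using hj)
        (by simpa [t1] using hf) (by simpa [t3] using hσ) (by simpa using hS)
      have h10 : (t.write 22 0 i) 10 0 = i := by simpa using hP.2.2 hS
      exact ⟨k1, by omega, fun _ => by omega⟩
    · rw [den_searchRound_of_ne (by simpa using hS)]
      exact ⟨hw, by simpa using hP.2.1.trans (Nat.le_succ i), fun h => absurd (by simpa using h) hS⟩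
  · intro t v hP
    simpa [IsSearch] using hP

/-! #### The backward scan -/

/-- The round of the search that is considered by the scan. -/
def scanIndexE : Expr := .op .sub (.op .sub (var 10) (.lit 1)) (var 22)

/-- The log may be shorter than the `n` rounds of the loop; surplus rounds idle. Cell `0` of array
`11` is updated first and then supplies the new label. -/
def scanRound : Prog :=
  cond (.op .lt (var 22) (var 10))
    (cond (neE (.get 3 (.get 8 scanIndexE)) (var 11)) skip
      (seq (assign 11 (.lit 0) (.get 9 scanIndexE)) (assign 3 (.get 8 scanIndexE) (var 11)))) skip

def scan : Prog := seq (assign 11 (.lit 0) (.lit 0)) (forLoop 22 1 0 scanRound)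

theorem den_scan {s : Store} {j₀ : ℕ} (h : IsSearch j₀ s) (hS : s 6 0 ≠ 0)
    (hK : s 10 0 ≤ s 1 0) :
    Dual (s 1 0) (s 1 1) (arcCost (s 1) (s 2 0)) ((scan.den s) 3) (s 4) (s 5) ∧
      ∀ l, count (s 1 0) ((scan.den s) 3) l + (if l = 0 then 1 else 0) =
        count (s 1 0) (s 3) l + if l = j₀ then 1 else 0 := by
  have key := forLoop_inv (x := 22) (a := 1) (k := 0) (N := s 1 0) (p := scanRound)
    (s := s.write 11 0 0)
    (fun i t => Scan (s 1 0) (s 1 1) (arcCost (s 1) (s 2 0)) (s 3) j₀ (s 4) (s 5) (s 8)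
      (s 10 0 - i) (t 3) (t 11 0)) (by simp) ?_ ?_ ?_
  -- After `n` rounds the whole log has been read, so the surplus can only sit at `j₀`.
  · rw [Nat.sub_eq_zero_of_le hK] at key
    refine ⟨key.dual, fun l => ?_⟩
    have := key.count l
    rwa [key.reached_zero] at this
  · simpa using Search.scan h hS
  · intro i hi t ht hP
    have g : ∀ a ∈ [8, 9, 10], t a = s a := by
      intro a ha
      simp only [List.mem_cons, List.not_mem_nil, or_false] at ha
      rw [ht a, Store.write_of_ne]
      · omega
      · simp only [scanRound, writes, List.mem_cons, List.not_mem_nil, or_false, not_or,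
          List.append_nil, List.nil_append, List.cons_append]
        omega
    by_cases hi' : i < s 10 0
    · obtain ⟨k, hk⟩ : ∃ k, s 10 0 - i = k + 1 := ⟨s 10 0 - i - 1, by omega⟩
      have hk1 : s 10 0 - (i + 1) = k := by omega
      have hk2 : s 10 0 - 1 - i = k := by omega
      rw [hk] at hP
      rw [hk1]
      by_cases hc : t 3 (s 8 k) = t 11 0
      · have hd : ∀ a ≠ 22, scanRound.den (t.write 22 0 i) a =
            ((t.write 11 0 (s 9 k)).write 3 (s 8 k) (s 9 k)) a := by
          intro a ha
          have hne : (neE (.get 3 (.get 8 scanIndexE)) (var 11)).eval (t.write 22 0 i) = 0 := by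
            simp [Expr.eval, scanIndexE, Op.eval, g, hk2, hc]
          simp only [scanRound, den, hne]
          by_cases h3 : a = 3
          · subst h3
            simp [Expr.eval, scanIndexE, Op.eval, g, hk2, hi']
          · by_cases h11 : a = 11
            · subst h11
              simp [Expr.eval, scanIndexE, Op.eval, g, hk2, hi']
            · simp [Expr.eval, Op.eval, g, hi', h3, h11, ha]
        rw [hd 3 (by simp), hd 11 (by simp)]
        simpa using hP.step_of_eq h (by omega) hc
      · have hd : scanRound.den (t.write 22 0 i) = t.write 22 0 i := by
          have hne : (neE (.get 3 (.get 8 scanIndexE)) (var 11)).eval (t.write 22 0 i) ≠ 0 := by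
            simp [Expr.eval, scanIndexE, Op.eval, g, hk2, hc]
          simp only [scanRound, den]
          rw [if_pos hne, ite_self]
        rw [hd]
        simpa using hP.step_of_ne hc
    · have hd : scanRound.den (t.write 22 0 i) = t.write 22 0 i := by
        simp [scanRound, den, Expr.eval, Op.eval, g, hi']
      rw [hd]
      rw [show s 10 0 - (i + 1) = s 10 0 - i by omega]
      simpa using hP
  · intro t v hP
    simpa using hP

end Assignment

namespace Assignment

open Ram Ram.Prog

/-! #### The main loop -/

/-- Raise the number of robots of the current task by one, up to its requirement. -/
def augment : Prog :=
  cond (.op .lt (var 21) (.get 1 (.op .add (.lit 2) (var 20)))) (seq search scan) skip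

/-- The inner loop runs `n` times rather than `q j` times, since a tame loop is bounded by one of
the first two input cells and `q j ≤ n`. -/
def allocate : Prog := seq denominator (forLoop 20 1 1 (forLoop 21 1 0 augment))

/-- The store holds a labelling with complementary potentials such that label `l + 1` has `u l`
robots. -/
def IsPartial (u : ℕ → ℕ) (s : Store) : Prop :=
  Dual (s 1 0) (s 1 1) (arcCost (s 1) (s 2 0)) (s 3) (s 4) (s 5) ∧
    ∀ l < s 1 1, count (s 1 0) (s 3) (l + 1) = u l

/-- No task has too many robots and task `j` has too few, so fewer than `∑ q ≤ n` robots are busy.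
-/
theorem exists_free {n m : ℕ} {σ q : ℕ → ℕ} {j : ℕ} (hσ : ∀ i < n, σ i ≤ m)
    (hq : ∑ l ∈ Finset.range m, q l ≤ n) (hc : ∀ l < m, count n σ (l + 1) ≤ q l) (hj : j < m)
    (hlt : count n σ (j + 1) < q j) : ∃ f < n, σ f = 0 := by
  have h1 := sum_count hσ
  rw [Finset.sum_range_succ'] at h1
  have h2 : ∑ l ∈ Finset.range m, count n σ (l + 1) < ∑ l ∈ Finset.range m, q l :=
    Finset.sum_lt_sum (fun l hl => hc l (Finset.mem_range.1 hl)) ⟨j, Finset.mem_range.2 hj, hlt⟩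
  have h3 : 0 < count n σ 0 := by omega
  obtain ⟨f, hf⟩ := Finset.card_pos.1 h3
  rw [Finset.mem_filter, Finset.mem_range] at hf
  exact ⟨f, hf⟩

theorem den_search_of_notMem {a : ℕ} (s : Store) (h : a ∈ [1, 2, 3, 20, 21]) :
    (search.den s) a = s a := by
  refine den_frame _ (fun hw => ?_) s
  simp only [search, startSearch, clearLabels, clearRobots, searchRound, leastSlack,
    leastSlackInner, raiseLabels, raiseRobots, visit, writes, List.mem_cons, List.not_mem_nil,
    or_false, List.append_nil, List.nil_append, List.cons_append] at hw h
  omega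

theorem den_scan_of_notMem {a : ℕ} (s : Store) (h : a ∈ [1, 2, 4, 5, 20, 21]) :
    (scan.den s) a = s a := by
  refine den_frame _ (fun hw => ?_) s
  simp only [scan, scanRound, writes, List.mem_cons, List.not_mem_nil, or_false,
    List.append_nil, List.nil_append, List.cons_append] at hw h
  omega

/-- The minimum treats productive and idle rounds uniformly: once the requirement is met, it no
longer changes. -/
theorem den_augment {s : Store} {u : ℕ → ℕ} (h : IsPartial u s) (hj : s 20 0 < s 1 1)
    (hq : ∑ l ∈ Finset.range (s 1 1), s 1 (2 + l) ≤ s 1 0)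
    (hu : ∀ l < s 1 1, u l ≤ s 1 (2 + l)) (hr : u (s 20 0) = min (s 21 0) (s 1 (2 + s 20 0))) :
    IsPartial (Function.update u (s 20 0) (min (s 21 0 + 1) (s 1 (2 + s 20 0))))
      (augment.den s) := by
  by_cases hlt : s 21 0 < s 1 (2 + s 20 0)
  · have hd : augment.den s = scan.den (search.den s) := by
      simp [augment, den, Expr.eval, Op.eval, hlt]
    obtain ⟨f, hf, hσ⟩ := exists_free h.1.label_le hq (fun l hl => (h.2 l hl).le.trans (hu l hl)) hj
      (by rw [h.2 _ hj, hr]; omega)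
    obtain ⟨k1, k2, k3⟩ := den_search h.1 hj hf hσ
    have e := fun a ha => den_search_of_notMem (a := a) s ha
    obtain ⟨l1, l2⟩ := den_scan k1 k2 (by rwa [e 1 (by simp)])
    have e' := fun a ha => den_scan_of_notMem (a := a) (search.den s) ha
    rw [hd]
    simp only [IsPartial, e' 1 (by simp), e' 2 (by simp), e' 4 (by simp), e' 5 (by simp)]
    refine ⟨l1, fun l hl => ?_⟩
    have h1 := l2 (l + 1)
    rw [e 1 (by simp)] at hl h1 ⊢
    rw [e 3 (by simp), h.2 l hl, if_neg (by omega), add_zero] at h1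
    rw [h1]
    by_cases hl' : l = s 20 0
    · subst hl'
      rw [if_pos rfl, Function.update_self, hr]
      omega
    · rw [if_neg (by omega), Function.update_of_ne hl', add_zero]
  · have hd : augment.den s = s := by
      simp [augment, den, Expr.eval, Op.eval, hlt]
    rw [hd, show min (s 21 0 + 1) (s 1 (2 + s 20 0)) = u (s 20 0) by omega,
      Function.update_eq_self]
    exact h

theorem den_allocate {s : Store}
    (hpos : ∀ i < s 1 0, ∀ l, 1 ≤ l → l ≤ s 1 1 → s 1 (address (s 1 1) i l + 1) ≠ 0)
    (hq : ∑ l ∈ Finset.range (s 1 1), s 1 (2 + l) ≤ s 1 0)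
    (h3 : ∀ i, s 3 i = 0) (h4 : ∀ i, s 4 i = 0) (h5 : ∀ i, s 5 i = 0) :
    ∃ d ≠ 0, (∀ i < s 1 0, ∀ l, 1 ≤ l → l ≤ s 1 1 → s 1 (address (s 1 1) i l + 1) ∣ d) ∧
      ∃ y z, Dual (s 1 0) (s 1 1) (arcCost (s 1) d) ((allocate.den s) 3) y z ∧
        ∀ l < s 1 1, count (s 1 0) ((allocate.den s) 3) (l + 1) = s 1 (2 + l) := by
  obtain ⟨hd0, hd⟩ := den_denominator s hpos
  have f1 : ∀ a ∈ [1, 3, 4, 5], (denominator.den s) a = s a := by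
    intro a ha
    refine den_frame _ (fun hw => ?_) s
    simp only [denominator, writes, List.mem_cons, List.not_mem_nil, or_false,
      List.cons_append, List.nil_append] at ha hw
    omega
  refine ⟨_, hd0, hd, ?_⟩
  rw [allocate, den]
  revert f1
  generalize denominator.den s = s₁
  intro f1
  have e1 := f1 1 (by simp)
  have e3 := f1 3 (by simp)
  have e4 := f1 4 (by simp)
  have e5 := f1 5 (by simp)
  rw [← e1] at hq ⊢
  rw [← e3] at h3
  rw [← e4] at h4
  rw [← e5] at h5
  have haug : ∀ a ∈ [1, 2, 20], a ∉ augment.writes := by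
    intro a ha hw
    simp only [augment, search, startSearch, clearLabels, clearRobots, searchRound, leastSlack,
      leastSlackInner, raiseLabels, raiseRobots, visit, scan, scanRound, writes, List.mem_cons,
      List.not_mem_nil, or_false, List.append_nil, List.nil_append, List.cons_append] at ha hw
    omega
  have key := forLoop_inv (x := 20) (a := 1) (k := 1) (p := forLoop 21 1 0 augment) (s := s₁)
    (fun j t => t 1 = s₁ 1 ∧ t 2 = s₁ 2 ∧
      IsPartial (fun l => if l < j then s₁ 1 (2 + l) else 0) t) rfl ?_ ?_ ?_
  · obtain ⟨k1, k2, k3, k4⟩ := key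
    rw [k1, k2] at k3
    rw [k1] at k4
    refine ⟨_, _, k3, fun l hl => ?_⟩
    rw [k4 l hl]
    exact if_pos hl
  -- With no robot allocated, zero potentials are feasible because the costs are non-negative, and
  -- complementarity is trivial.
  · refine ⟨rfl, rfl, ⟨fun i _ => by simp [h3], fun i _ l _ _ => by simp [h4],
      fun i _ h => absurd (h3 i) h, fun i _ _ => h5 i⟩, fun l _ => ?_⟩
    simp [count, h3]
  · rintro j hj t - ⟨t1, t2, ht⟩
    have inner := forLoop_inv (x := 21) (a := 1) (k := 0) (N := s₁ 1 0) (p := augment)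
      (s := t.write 20 0 j)
      (fun r t => t 1 = s₁ 1 ∧ t 2 = s₁ 2 ∧ t 20 0 = j ∧
        IsPartial (fun l => if l < j then s₁ 1 (2 + l) else if l = j then
          min r (s₁ 1 (2 + j)) else 0) t) (by simp [t1]) ?_ ?_ ?_
    · obtain ⟨k1, k2, -, k3⟩ := inner
      refine ⟨k1, k2, k3.1, fun l hl => ?_⟩
      -- Each single requirement is at most `n`, so `n` rounds fill task `j`.
      have hqj : s₁ 1 (2 + j) ≤ s₁ 1 0 := (Finset.single_le_sum (f := fun l => s₁ 1 (2 + l))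
        (fun _ _ => Nat.zero_le _) (Finset.mem_range.2 hj)).trans hq
      rw [k3.2 l hl]
      beta_reduce
      rcases lt_trichotomy l j with h | rfl | h
      · rw [if_pos h, if_pos (by omega)]
      · rw [if_neg (lt_irrefl _), if_pos rfl, if_pos (by omega), min_eq_right hqj]
      · rw [if_neg (by omega), if_neg (by omega), if_neg (by omega)]
    · refine ⟨by simpa using t1, by simpa using t2, by simp, ?_⟩
      simpa [IsPartial] using ht
    · rintro r hr v - ⟨v1, v2, v20, hv⟩
      have hw : IsPartial (fun l => if l < j then s₁ 1 (2 + l) else if l = j then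
          min r (s₁ 1 (2 + j)) else 0) (v.write 21 0 r) := by simpa [IsPartial] using hv
      have := den_augment hw (by simpa [v1, v20] using hj) (by simpa [v1] using hq)
        (by
          intro l _
          simp only [ne_eq, OfNat.one_ne_ofNat, not_false_eq_true, Store.write_of_ne, v1]
          split_ifs with h1 h2
          · exact le_rfl
          · rw [h2]; exact min_le_right _ _
          · exact Nat.zero_le _)
        (by simp [v1, v20])
      refine ⟨?_, ?_, ?_, ?_⟩
      · rw [den_frame _ (haug 1 (by simp))]; simpa using v1
      · rw [den_frame _ (haug 2 (by simp))]; simpa using v2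
      · rw [den_frame _ (haug 20 (by simp))]; simpa using v20
      · convert this using 1
        funext l
        by_cases hl : l = j
        · subst hl; simp [v1, v20]
        · simp [v20, hl]
    · intro v w hv
      simpa [IsPartial] using hv
  · intro t v ht
    simpa [IsPartial] using ht

/-! ### Output and total running time. -/

/-- Copy the labels to the output array. -/
def copyLabels : Prog := forLoop 22 0 0 (assign 1 (var 22) (.get 3 (var 22)))

theorem den_copyLabels (s : Store) {i : ℕ} (hi : i < s 0 0) : (copyLabels.den s) 1 i = s 3 i := by
  have := den_forLoop_map (x := 22) (a := 0) (k := 0) (s := s)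
    (p := assign 1 (var 22) (.get 3 (var 22))) 1 0 (fun i => s 3 i) rfl (by simp) ?_ i
  · rw [if_pos (by omega)] at this
    exact this
  · intro i hi t ht _ j
    have h3 : t 3 = s 3 := ht 3 (by simp [writes])
    simp [den, Expr.eval, h3, Function.update_apply]

theorem tame_allocate : allocate.Tame 1 := by
  simp [allocate, denominator, augment, search, startSearch, clearLabels, clearRobots, searchRound,
    leastSlack, leastSlackInner, slackE, raiseLabels, raiseRobots, visit, scan, scanRound,
    scanIndexE, neE, arcCostE, addressE, succE, var, writes, Prog.Tame, Expr.Tame]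

/-- The copy overwrites array `1`, so array `0` takes over the role of the read-only array. -/
theorem tame_copyLabels : copyLabels.Tame 0 := by
  simp [copyLabels, var, writes, Prog.Tame, Expr.Tame]

theorem not_mem_writes_allocate : 0 ∉ allocate.writes := by
  simp [allocate, denominator, augment, search, startSearch, clearLabels, clearRobots, searchRound,
    leastSlack, leastSlackInner, raiseLabels, raiseRobots, visit, scan, scanRound, writes]

/-- The number of robots is saved in array `0` before the input is overwritten; it serves both as
loop bound and as output length. -/
def program : Cmd :=
  .seq allocate.compile (.seq (.assign 0 (.lit 0) (.get 1 (.lit 0))) copyLabels.compile)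

theorem length_le_bitSize (w : List ℕ) : w.length ≤ bitSize w := by
  induction w with
  | nil => simp [bitSize]
  | cons x w ih => simp only [bitSize, List.map_cons, List.sum_cons, List.length_cons] at *; omega

theorem size_le_bitSize {w : List ℕ} {x : ℕ} (h : x ∈ w) : Nat.size x ≤ bitSize w := by
  have := List.single_le_sum (l := w.map fun x => Nat.size x + 1) (fun _ _ => Nat.zero_le _) _
    (List.mem_map_of_mem h)
  simp only [bitSize]
  omega

open Polynomial in
/-- The program runs in polynomial time, provided that the first two entries of the input are at
most its size. -/
theorem exec_program : ∃ p : ℕ[X], ∀ w : List ℕ, w ≠ [] → w.getD 0 0 ≤ bitSize w →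
    w.getD 1 0 ≤ bitSize w → ∃ t ≤ p.eval (bitSize w), ∃ s, Exec program (Store.init w) t s ∧
      s 0 0 = w.getD 0 0 ∧ ∀ i < w.getD 0 0, s 1 i = (allocate.den (Store.init w)) 3 i := by
  obtain ⟨G₁, C₁, k₁⟩ := tame_allocate.exec
  obtain ⟨G₂, C₂, k₂⟩ := tame_copyLabels.exec
  -- `4 + X` pays for the assignment between the two phases. The copy starts with cells of up to `N
  -- + G₁(N)` bits, hence the composition.
  refine ⟨C₁ * (1 + X) + ((4 + X) + (C₂ * (1 + X)).comp (X + G₁)), fun w hw h0 h1 => ?_⟩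
  set N := bitSize w with hN
  have hlen : w.length ≤ N := length_le_bitSize w
  have hpos : 0 < N := (List.length_pos_iff.2 hw).trans_le hlen
  have hentry : ∀ i, w.getD i 0 < 2 ^ N := by
    intro i
    by_cases hi : i < w.length
    · rw [List.getD_eq_getElem _ _ hi]
      exact Nat.size_le.1 (size_le_bitSize (List.getElem_mem hi))
    · rw [List.getD_eq_default _ _ (by omega)]
      positivity
  have hinit : (Store.init w).Bounded 1 N N := by
    refine ⟨fun a i => ?_, hentry, hpos, fun k hk => ?_⟩
    · unfold Store.init
      split
      · exact hlen.trans_lt Nat.lt_two_pow_self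
      · exact hentry _
      · positivity
    · interval_cases k
      · exact h0
      · exact h1
  obtain ⟨b₁, t₁, l₁, e₁⟩ := k₁ _ N N hinit
  set s₁ := allocate.den (Store.init w) with hs₁
  have hs10 : s₁ 1 0 = w.getD 0 0 := by
    rw [hs₁, den_frame _ tame_allocate.not_mem_writes]; rfl
  -- `Store.Bounded` limits the first two cells of the read-only array; the second one of array `0`
  -- has never been written.
  have hs01 : s₁ 0 1 = 0 := by
    rw [hs₁, den_frame _ not_mem_writes_allocate]; rfl
  have e₂ := Exec.assign 0 (.lit 0) (.get 1 (.lit 0)) s₁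
  change Exec _ _ _ (s₁.write 0 0 (s₁ 1 0)) at e₂
  set B := N + G₁.eval N with hB
  have hsmall : s₁ 1 0 ≤ N := by rw [hs10]; exact h0
  have b₂ : (s₁.write 0 0 (s₁ 1 0)).Bounded 0 B B := by
    have hcell : ∀ a i, (s₁.write 0 0 (s₁ 1 0)) a i < 2 ^ B := by
      intro a i
      by_cases ha : a = 0
      · subst ha
        by_cases hi : i = 0
        · subst hi; simpa using b₁.cell 1 0
        · simpa [hi] using b₁.cell 0 i
      · simpa [ha] using b₁.cell a i
    refine ⟨hcell, hcell 0, by omega, fun k hk => ?_⟩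
    interval_cases k
    · simp only [Store.write_self, Function.update_self]; omega
    · simp [hs01]
  obtain ⟨-, t₃, l₃, e₃⟩ := k₂ _ B B b₂
  refine ⟨_, ?_, _, .seq e₁ (.seq e₂ e₃), ?_, fun i hi => ?_⟩
  · have : Nat.size (s₁ 1 0) ≤ N := Nat.size_le.2 (Nat.lt_two_pow_self.trans_le
      (Nat.pow_le_pow_right two_pos hsmall))
    simp only [eval_add, eval_mul, eval_comp, eval_X, eval_one, eval_ofNat, Expr.cost, Expr.eval,
      Nat.size_zero]
    rw [← hB]
    omega
  · rw [den_frame]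
    · simp [hs10]
    · simp [copyLabels, writes]
  · rw [den_copyLabels _ (by simpa [hs10] using hi)]
    simp

end Assignment

/-! ### Instances as inputs -/

namespace TaskInstance

open Assignment Ram

variable (I : TaskInstance)

/-- The label of a robot: `0` without a task, `j + 1` for task `j`. -/
def label (σ : I.Allocation) (i : ℕ) : ℕ :=
  if h : i < I.n then (σ ⟨i, h⟩).elim 0 fun j => (j : ℕ) + 1 else 0

variable {I}

theorem label_fin (σ : I.Allocation) (i : Fin I.n) :
    I.label σ i = (σ i).elim 0 fun j => (j : ℕ) + 1 := by
  simp [label]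

theorem label_le (σ : I.Allocation) {i : ℕ} (hi : i < I.n) : I.label σ i ≤ I.m := by
  rw [label, dif_pos hi]
  cases σ ⟨i, hi⟩ with
  | none => simp
  | some j => simp

theorem count_label (σ : I.Allocation) (j : Fin I.m) :
    count I.n (I.label σ) (j + 1) = (Finset.univ.filter fun i => σ i = some j).card := by
  rw [count, Finset.card_filter, Finset.card_filter, Finset.sum_range]
  refine Finset.sum_congr rfl fun i _ => if_congr ?_ rfl rfl
  rw [label_fin]
  cases σ i with
  | none => simp
  | some k => simp [Fin.ext_iff]

theorem weight_label (σ : I.Allocation) {w : ℕ → ℕ → ℕ} {d : ℕ}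
    (hw : ∀ (i : Fin I.n) (j : Fin I.m), (w i (j + 1) : ℚ≥0) = d * I.c i j) :
    (weight I.n w (I.label σ) : ℚ≥0) = d * I.totalCost σ := by
  rw [weight, Finset.sum_range, totalCost, Finset.mul_sum, Nat.cast_sum]
  refine Finset.sum_congr rfl fun i _ => ?_
  rw [label_fin]
  cases h : σ i with
  | none => simp
  | some k => simp [hw]

/-- A labelling of minimum weight is an optimal allocation. -/
theorem exists_isOptimal {w : ℕ → ℕ → ℕ} {d : ℕ} (hd : d ≠ 0)
    (hw : ∀ (i : Fin I.n) (j : Fin I.m), (w i (j + 1) : ℚ≥0) = d * I.c i j) {f y z : ℕ → ℕ}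
    (hf : Dual I.n I.m w f y z) (hc : ∀ j : Fin I.m, count I.n f (j + 1) = I.q j) :
    ∃ σ : I.Allocation, I.IsOptimal σ ∧ ∀ i : Fin I.n,
      ((σ i).elim 0 fun j => (j : ℕ) + 1) = f i := by
  let σ : I.Allocation := fun i => if h : f i ≠ 0 then
    some ⟨f i - 1, by have := hf.label_le i i.isLt; omega⟩ else none
  have hσ : ∀ i : Fin I.n, ((σ i).elim 0 fun j => (j : ℕ) + 1) = f i := by
    intro i
    by_cases h : f i = 0
    · simp [σ, h]
    · simp only [σ, ne_eq, h, not_false_eq_true, dite_true, Option.elim]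
      omega
  have hl : ∀ i < I.n, I.label σ i = f i := fun i hi => (label_fin σ ⟨i, hi⟩).trans (hσ _)
  have hcount : ∀ l, count I.n (I.label σ) l = count I.n f l := by
    intro l
    rw [count, count]
    congr 1
    exact Finset.filter_congr fun i hi => by rw [hl i (Finset.mem_range.1 hi)]
  have hweight : weight I.n w (I.label σ) = weight I.n w f :=
    Finset.sum_congr rfl fun i hi => by rw [hl i (Finset.mem_range.1 hi)]
  refine ⟨σ, ⟨fun j => ?_, fun τ hτ => ?_⟩, hσ⟩
  · rw [Handles, ← count_label, hcount, hc]
  -- The constructed labelling meets each requirement exactly, so every competitor has at least as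
  -- many robots on each task.
  · have h1 := hf.weight_le (τ := I.label τ) (fun i hi => label_le τ hi) (fun l h1 hlm => by
      obtain ⟨l, rfl⟩ := Nat.exists_eq_add_of_le' h1
      have := hτ ⟨l, by omega⟩
      rw [Handles, ← count_label] at this
      exact (hc ⟨l, by omega⟩).le.trans this)
    rw [← hweight, ← Nat.cast_le (α := ℚ≥0), weight_label σ hw, weight_label τ hw] at h1
    exact le_of_mul_le_mul_left h1 (by positivity)

/-! ### Entries of the encoded instance. -/

theorem getD_flatMap {α : Type*} {k : ℕ} (f : α → List ℕ) (l : List α)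
    (hf : ∀ a, (f a).length = k) {i r : ℕ} (hi : i < l.length) (hr : r < k) :
    (l.flatMap f).getD (i * k + r) 0 = (f l[i]).getD r 0 := by
  induction l generalizing i with
  | nil => simp at hi
  | cons a l ih =>
    rw [List.flatMap_cons]
    cases i with
    | zero => rw [zero_mul, zero_add, List.getD_append _ _ _ _ (by rwa [hf])]; rfl
    | succ i =>
      have e : (i + 1) * k + r = k + (i * k + r) := by ring
      rw [List.getD_append_right _ _ _ _ (by rw [hf]; omega), hf, e, Nat.add_sub_cancel_left,
        ih (by simpa using hi)]
      rfl

theorem length_flatMap {α : Type*} {k : ℕ} (f : α → List ℕ) (l : List α)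
    (hf : ∀ a, (f a).length = k) : (l.flatMap f).length = l.length * k := by
  simp [List.length_flatMap, hf]

variable (I)

/-- The record of a robot in the encoding of an instance. -/
def record (i : Fin I.n) : List ℕ :=
  i.val :: (List.finRange I.m).flatMap fun j => [(I.c i j).num, (I.c i j).den]

theorem length_record (i : Fin I.n) : (I.record i).length = 2 * I.m + 1 := by
  rw [record, List.length_cons, length_flatMap (k := 2) _ _ fun _ => rfl, List.length_finRange,
    mul_comm]

theorem encode_eq : I.encode =
    I.n :: I.m :: (List.ofFn I.q ++ (List.finRange I.n).flatMap I.record) := rfl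

theorem length_encode : I.encode.length = 2 + I.m + I.n * (2 * I.m + 1) := by
  rw [encode_eq, List.length_cons, List.length_cons, List.length_append, List.length_ofFn,
    length_flatMap _ _ I.length_record, List.length_finRange]
  omega

theorem encode_getD_requirement (j : Fin I.m) : I.encode.getD (2 + j) 0 = I.q j := by
  rw [encode_eq, add_comm, List.getD_cons_succ, List.getD_cons_succ,
    List.getD_append _ _ _ _ (by simp), List.getD_eq_getElem _ _ (by simp)]
  simp

theorem encode_getD_record (i : Fin I.n) {r : ℕ} (hr : r < 2 * I.m + 1) :
    I.encode.getD (2 + I.m + (i * (2 * I.m + 1) + r)) 0 = (I.record i).getD r 0 := by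
  have e : 2 + I.m + (i * (2 * I.m + 1) + r) = (I.m + (i * (2 * I.m + 1) + r)) + 1 + 1 := by ring
  rw [encode_eq, e, List.getD_cons_succ, List.getD_cons_succ,
    List.getD_append_right _ _ _ _ (by simp), List.length_ofFn, Nat.add_sub_cancel_left,
    getD_flatMap _ _ I.length_record (by simp) hr]
  simp

theorem record_getD (i : Fin I.n) (j : Fin I.m) {r : ℕ} (hr : r < 2) :
    (I.record i).getD (j * 2 + r + 1) 0 = [(I.c i j).num, (I.c i j).den].getD r 0 := by
  rw [record, List.getD_cons_succ, getD_flatMap (k := 2) _ _ (fun _ => rfl) (by simp) hr]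
  simp

theorem encode_getD_address (i : Fin I.n) (j : Fin I.m) :
    I.encode.getD (address I.m i (j + 1)) 0 = (I.c i j).num ∧
      I.encode.getD (address I.m i (j + 1) + 1) 0 = (I.c i j).den := by
  have hj := j.isLt
  constructor
  -- The header has `2 + m` entries and each record opens with the robot's number; since labels
  -- start at `1`, the offset in `address` is `2 + m + 1 - 2 = 1 + m`.
  · have e : address I.m i (j + 1) = 2 + I.m + (i * (2 * I.m + 1) + (j * 2 + 0 + 1)) := by
      rw [address]; ring
    rw [e, encode_getD_record I i (by omega), record_getD I i j (r := 0) (by omega)]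
    rfl
  · have e : address I.m i (j + 1) + 1 = 2 + I.m + (i * (2 * I.m + 1) + (j * 2 + 1 + 1)) := by
      rw [address]; ring
    rw [e, encode_getD_record I i (by omega), record_getD I i j (r := 1) (by omega)]
    rfl

/-- Divisibility makes the rounded division exact, so the integral cost is the rational one scaled
by `d`. -/
theorem arcCost_encode {d : ℕ} (i : Fin I.n) (j : Fin I.m) (hd : (I.c i j).den ∣ d) :
    (arcCost (fun k => I.encode.getD k 0) d i (j + 1) : ℚ≥0) = d * I.c i j := by
  obtain ⟨h1, h2⟩ := I.encode_getD_address i j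
  have hm : I.encode.getD 1 0 = I.m := rfl
  have hden : ((I.c i j).den : ℚ≥0) ≠ 0 := by exact_mod_cast (I.c i j).den_ne_zero
  rw [arcCost, hm, h1, h2, Nat.cast_mul, Nat.cast_div hd hden]
  conv_rhs => rw [← NNRat.num_div_den (I.c i j)]
  field_simp

end TaskInstance

open TaskInstance Assignment Ram in
theorem mainTheorem9 :
    ∃ (P : Ram.Cmd) (p : Polynomial ℕ), ∀ I : TaskInstance, ∑ j, I.q j ≤ I.n →
      ∃ σ : I.Allocation, I.IsOptimal σ ∧
        Ram.OutputsWithin P I.encode (I.encodeAllocation σ) (p.eval (Ram.bitSize I.encode)) := by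
  obtain ⟨p, hp⟩ := exec_program
  refine ⟨program, p, fun I hI => ?_⟩
  have hlen := length_le_bitSize I.encode
  rw [length_encode] at hlen
  -- Every robot contributes a non-empty record, so `n` is at most the input size even when `m = 0`.
  have hn : I.n ≤ I.n * (2 * I.m + 1) := Nat.le_mul_of_pos_right _ (by omega)
  have hn0 : I.encode.getD 0 0 = I.n := rfl
  obtain ⟨t, ht, s, hs, h0, h1⟩ := hp I.encode (by simp [encode_eq])
    (show I.n ≤ _ by omega) (show I.m ≤ _ by omega)
  have hq : ∑ l ∈ Finset.range I.m, I.encode.getD (2 + l) 0 ≤ I.n := by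
    rw [Finset.sum_range]
    simpa only [encode_getD_requirement] using hI
  obtain ⟨d, hd, hdvd, y, z, hdual, hcount⟩ := den_allocate (s := Store.init I.encode)
    (by
      intro i hi l hl hlm
      obtain ⟨l, rfl⟩ := Nat.exists_eq_add_of_le' hl
      have := (I.encode_getD_address ⟨i, hi⟩ ⟨l, hlm⟩).2
      exact this.trans_ne (NNRat.den_ne_zero _)) hq (fun _ => rfl) (fun _ => rfl) (fun _ => rfl)
  obtain ⟨σ, hσ, hlabel⟩ := exists_isOptimal hd (I := I)
    (fun i j => I.arcCost_encode i j (by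
      have := hdvd i i.isLt (j + 1) (by omega) j.isLt
      rwa [← (I.encode_getD_address i j).2])) hdual
    (fun j => (hcount j j.isLt).trans (I.encode_getD_requirement j))
  refine ⟨σ, hσ, t, s, hs, ⟨?_, fun i hi => ?_⟩, ht⟩
  · rw [h0, encodeAllocation, List.length_ofFn, hn0]
  · have hi' : i < I.n := by simpa [encodeAllocation] using hi
    rw [h1 i hi', ← hlabel ⟨i, hi'⟩]
    simp [encodeAllocation]
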